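/- \textbf{Setting.} An instance of two-stage stochastic uncapacitated facility location consists of a finite set $\mathcal F$ of facilities and a set $\mathcal D$ of clients, located in a common (pseudo)metric space with distances $c_{ij}$ ($i\in\mathcal F$, $j\in\mathcal D$), finitely many scenarios $A$, each a finite set of clients, and opening costs $f_i^I\ge 0$ (Stage I) and $f_i^A\ge 0$ (Stage II of scenario $A$). Let $(x^*,y^*)$ be any feasible solution of the LP relaxation: $\sum_i x^*_{A,ij}\ge 1$, $x^*_{A,ij}\le y^*_i+y^*_{A,i}$ and $x^*_{A,ij}\ge 0$ for all $i$, $A$, $j\in A$, and $y^*_i,y^*_{A,i}\ge 0$. Its cost in scenario $A$ is \[ Val_A=\sum_{i}(f_i^I y^*_i+f_i^A y^*_{A,i})+\sum_{j\in A}\sum_{i} c_{ij}x^*_{A,ij}. \] Write $x^{(1)}_{A,ij}=x^*_{A,ij}\frac{y^*_i}{y^*_i+y^*_{A,i}}$ and $x^{(2)}_{A,ij}=x^*_{A,ij}\frac{y^*_{A,i}}{y^*_i+y^*_{A,i}}$ (both $0$ if $x^*_{A,ij}=0$). \textbf{Algorithm}, with parameter $\gamma=2.4957$. (1) \emph{Scaling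 and splitting.} Replace each facility $i$ by finitely many copies at the same location, each belonging to Stage I or to Stage II of one scenario. Each copy $k$ gets a fractional opening $\overline y_k\in[0,1]$ and, for every $j\in A$, a value $\overline x_{A,kj}\in\{0,\overline y_k\}$, which is $0$ if $k$ belongs to Stage II of a scenario other than $A$. Over the Stage I copies of $i$, the openings sum to $\gamma y^*_i$ and the values $\overline x_{A,kj}$ to $\gamma x^{(1)}_{A,ij}$; over its copies for Stage II of $A$, the openings sum to $\gamma y^*_{A,i}$ and the values $\overline x_{A,kj}$ to $\gamma x^{(2)}_{A,ij}$. The splitting is fine enough for the sets in (2) to exist. (2) \emph{Cluster candidates.} For $j\in A$ let $F^{I}_{(j,A)}$ be empty if $\sum_k\overline x_{A,kj}<1$, the sum being over Stage I copies. Otherwise let it be a set of Stage I copies with $\overline x_{A,kj}>0$ and $\sum_{k\in F^{I}_{(j,A)}}\overline x_{A,kj}=1$ that minimizes the maximal distance to $j$ among all sets $F'$ of Stage I copies with $\sum_{k\in F'}\overline x_{A,kj}\ge 1$. Define $F^{II}_{(j,A)}$ likewise with the copies for Stage II of $A$. Let $d^I_{(j,A)}$ and $d^{II}_{(j,A)}$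 be the maximal distances from $j$ to these sets ($+\infty$ for an empty set), and $d_{(j,A)}=\min\{d^I_{(j,A)},d^{II}_{(j,A)}\}$. If $d^I_{(j,A)}\le d^{II}_{(j,A)}$, the pair $(j,A)$ is first-stage clustered, with candidate $F_{(j,A)}=F^I_{(j,A)}$; otherwise it is second-stage clustered, with candidate $F_{(j,A)}=F^{II}_{(j,A)}$. (3) \emph{Greedy clustering.} In Stage I scan all first-stage clustered pairs (of all scenarios), and in Stage II of scenario $A$ scan all second-stage clustered pairs $(j,A)$, in each case in the order of non-decreasing $d_{(j,A)}$, ties being broken arbitrarily. If $F_{(j,A)}$ is disjoint from all clusters formed so far in that stage, it becomes a new cluster; otherwise nothing happens. (4) \emph{Random opening.} In each stage, open exactly one copy of each cluster, copy $k$ being chosen with probability $\overline y_k$, and open each unclustered copy $k$ of the stage with probability $\overline y_k$; all these choices are independent, also between the stages. An original facility is opened in a stage if one of its copies is, and its opening cost for that stage is then paid once. At the end of Stage II of scenario $A$, connect each client of $A$ to the closest facility opened in Stage I or in Stage II. \textbf{Theorem.} The algorithm can be carried out, that is, a splitting, candidate sets and orders as in (1)--(3) exist. For every such choice, the rule (4)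 defines a probability distribution on the sets of opened copies of each stage, and for every scenario $A$ the resulting solution is feasible with probability $1$ (whenever $A$ has a client, some facility is open) and its expected cost (opening costs of both stages plus connection costs) in scenario $A$ satisfies \[ \mathbf{E}[\mathrm{COST}(A)]\le 2.4957\cdot Val_A. \] -/

import Mathlib

namespace StochFacLoc

/-- An instance of two-stage stochastic uncapacitated facility location with facilities `F`,
clients `D` and scenarios `Ω`.  Facilities and clients are points of a (pseudo)metric space `X`;
opening facility `i` costs `f₁ i` in Stage I and `f₂ A i` in Stage II of scenario `A`. -/
structure Inst (F D Ω X : Type*) [PseudoMetricSpace X] where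
  facility : F → X
  client : D → X
  scenario : Ω → Finset D
  f₁ : F → ℝ
  f₂ : Ω → F → ℝ
  f₁_nonneg : ∀ i, 0 ≤ f₁ i
  f₂_nonneg : ∀ A i, 0 ≤ f₂ A i

section
variable {F D Ω X : Type*} [PseudoMetricSpace X]

/-- The distance `c i j` between facility `i` and client `j`. -/
def Inst.c (I : Inst F D Ω X) (i : F) (j : D) : ℝ := dist (I.facility i) (I.client j)

/-- A feasible solution of the standard LP relaxation. -/
structure FracSol [Fintype F] (I : Inst F D Ω X) where
  y₁ : F → ℝ
  y₂ : Ω → F → ℝ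
  x : Ω → F → D → ℝ
  y₁_nonneg : ∀ i, 0 ≤ y₁ i
  y₂_nonneg : ∀ A i, 0 ≤ y₂ A i
  x_nonneg : ∀ A i, ∀ j ∈ I.scenario A, 0 ≤ x A i j
  assign : ∀ A, ∀ j ∈ I.scenario A, 1 ≤ ∑ i, x A i j
  x_le : ∀ A i, ∀ j ∈ I.scenario A, x A i j ≤ y₁ i + y₂ A i

section
variable [Fintype F] {I : Inst F D Ω X}

/-- The fractional opening of facility `i` in a stage: `none` is Stage I, and `some A` is
Stage II of scenario `A`. -/
def FracSol.opening (s : FracSol I) : Option Ω → F → ℝ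
  | none, i => s.y₁ i
  | some A, i => s.y₂ A i

/-- The part of `x A i j` that is served in Stage I. If `y₁ i + y₂ A i = 0` then `x A i j = 0`
by feasibility, and the value here is `0`. -/
noncomputable def FracSol.x₁ (s : FracSol I) (A : Ω) (i : F) (j : D) : ℝ :=
  s.x A i j * (s.y₁ i / (s.y₁ i + s.y₂ A i))

/-- The part of `x A i j` that is served in Stage II. -/
noncomputable def FracSol.x₂ (s : FracSol I) (A : Ω) (i : F) (j : D) : ℝ :=
  s.x A i j * (s.y₂ A i / (s.y₁ i + s.y₂ A i))

/-- The fractional cost of scenario `A`. -/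
noncomputable def FracSol.val (s : FracSol I) (A : Ω) : ℝ :=
  ∑ i, (I.f₁ i * s.y₁ i + I.f₂ A i * s.y₂ A i) + ∑ j ∈ I.scenario A, ∑ i, I.c i j * s.x A i j

end

/-- The result of scaling a fractional solution by `γ` and splitting facilities.
`K` is the set of copies; `parent k` is the original facility of the copy `k`, and `stage k` is the
stage in which it may be opened (`none` is Stage I, `some A` is Stage II of scenario `A`).
The copies of a facility share its scaled fractional opening and its scaled assignments; no copy has
an opening above `1`, and each client-scenario pair uses a copy fully or not at all. -/
structure Splitting [Fintype F] [DecidableEq F] [DecidableEq Ω] {I : Inst F D Ω X}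
    (s : FracSol I) (γ : ℝ) (K : Type*) [Fintype K] where
  parent : K → F
  stage : K → Option Ω
  ybar : K → ℝ
  xbar : Ω → K → D → ℝ
  ybar_nonneg : ∀ k, 0 ≤ ybar k
  ybar_le_one : ∀ k, ybar k ≤ 1
  sum_ybar : ∀ (t : Option Ω) (i : F),
    ∑ k with parent k = i ∧ stage k = t, ybar k = γ * s.opening t i
  xbar_eq : ∀ A k, ∀ j ∈ I.scenario A, xbar A k j = 0 ∨ xbar A k j = ybar k
  xbar_other : ∀ A k, ∀ j ∈ I.scenario A, stage k ≠ none → stage k ≠ some A → xbar A k j = 0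
  sum_xbar₁ : ∀ A i, ∀ j ∈ I.scenario A,
    ∑ k with parent k = i ∧ stage k = none, xbar A k j = γ * s.x₁ A i j
  sum_xbar₂ : ∀ A i, ∀ j ∈ I.scenario A,
    ∑ k with parent k = i ∧ stage k = some A, xbar A k j = γ * s.x₂ A i j

section
variable [Fintype F] [DecidableEq F] [DecidableEq Ω] {I : Inst F D Ω X} {s : FracSol I} {γ : ℝ}
  {K : Type*} [Fintype K]

/-- The copies that belong to a stage. -/
def Splitting.copies (S : Splitting s γ K) (t : Option Ω) : Finset K := {k | S.stage k = t}

/-- The largest distance from client `j` to a copy in `G`; `⊤` if `G` is empty. -/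
noncomputable def Splitting.maxDist (S : Splitting s γ K) (j : D) (G : Finset K) : WithTop ℝ :=
  if h : G.Nonempty then ((G.sup' h (fun k => I.c (S.parent k) j) : ℝ) : WithTop ℝ) else ⊤

/-- `G` is the candidate set of the pair `(j, A)` in stage `t`.  It is empty if the copies of the
stage serve the pair to a total extent less than `1`.  Otherwise it consists of copies of the stage
that serve the pair, to a total extent of exactly `1`, and it minimises the largest distance to `j`
among all sets of copies of the stage that serve the pair to a total extent of at least `1`. -/
def Splitting.IsCandidate (S : Splitting s γ K) (t : Option Ω) (A : Ω) (j : D)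
    (G : Finset K) : Prop :=
  (∑ k ∈ S.copies t, S.xbar A k j < 1 → G = ∅) ∧
  (1 ≤ ∑ k ∈ S.copies t, S.xbar A k j →
    (G ⊆ S.copies t ∧ (∀ k ∈ G, 0 < S.xbar A k j) ∧ ∑ k ∈ G, S.xbar A k j = 1 ∧
      ∀ G' ⊆ S.copies t, 1 ≤ ∑ k ∈ G', S.xbar A k j → S.maxDist j G ≤ S.maxDist j G'))

end

/-- Greedy clustering: scan the list; a set that is disjoint from all the clusters formed so far
becomes a cluster, any other set is discarded. -/
def greedy {K : Type*} [DecidableEq K] (l : List (Finset K)) : List (Finset K) :=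
  l.foldl (fun acc C => if ∀ B ∈ acc, Disjoint C B then C :: acc else acc) []

/-- A run of the deterministic part of the algorithm, with every choice that it leaves open:
the splitting, the candidate sets, and the orders (with ties broken arbitrarily) in which
the pairs are scanned in Stage I and in Stage II of each scenario. -/
structure Run [Fintype F] [DecidableEq F] [DecidableEq Ω] {I : Inst F D Ω X}
    (s : FracSol I) (γ : ℝ) (K : Type*) [Fintype K] extends Splitting s γ K where
  cand₁ : Ω → D → Finset K
  cand₂ : Ω → D → Finset K
  cand₁_spec : ∀ A, ∀ j ∈ I.scenario A, toSplitting.IsCandidate none A j (cand₁ A j)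
  cand₂_spec : ∀ A, ∀ j ∈ I.scenario A, toSplitting.IsCandidate (some A) A j (cand₂ A j)
  order₁ : List (Ω × D)
  order₁_nodup : order₁.Nodup
  /-- Stage I scans the first-stage clustered pairs, those with `d¹ ≤ d²`, ... -/
  mem_order₁ : ∀ p : Ω × D, p ∈ order₁ ↔ p.2 ∈ I.scenario p.1 ∧
    toSplitting.maxDist p.2 (cand₁ p.1 p.2) ≤ toSplitting.maxDist p.2 (cand₂ p.1 p.2)
  /-- ... in the order of non-decreasing `d = d¹`. -/
  order₁_sorted : order₁.Pairwise fun p q =>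
    toSplitting.maxDist p.2 (cand₁ p.1 p.2) ≤ toSplitting.maxDist q.2 (cand₁ q.1 q.2)
  order₂ : Ω → List D
  order₂_nodup : ∀ A, (order₂ A).Nodup
  /-- Stage II of scenario `A` scans the second-stage clustered pairs, those with `d² < d¹`, ... -/
  mem_order₂ : ∀ A j, j ∈ order₂ A ↔ j ∈ I.scenario A ∧
    toSplitting.maxDist j (cand₂ A j) < toSplitting.maxDist j (cand₁ A j)
  /-- ... in the order of non-decreasing `d = d²`. -/
  order₂_sorted : ∀ A, (order₂ A).Pairwise fun j j' =>
    toSplitting.maxDist j (cand₂ A j) ≤ toSplitting.maxDist j' (cand₂ A j')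

namespace Run
variable [Fintype F] [DecidableEq F] [DecidableEq Ω] {I : Inst F D Ω X} {s : FracSol I} {γ : ℝ}
  {K : Type*} [Fintype K] [DecidableEq K]

/-- The clusters formed in a stage. -/
def clusters (R : Run s γ K) : Option Ω → List (Finset K)
  | none => greedy (R.order₁.map fun p => R.cand₁ p.1 p.2)
  | some A => greedy ((R.order₂ A).map fun j => R.cand₂ A j)

/-- The probability that a random choice of one copy of the cluster `C`, with the probabilities
`ybar`, yields the set `O ∩ C`. -/
noncomputable def clusterProb (R : Run s γ K) (C O : Finset K) : ℝ :=
  ∑ k ∈ C, if O ∩ C = {k} then R.ybar k else 0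

/-- The probability that `O` is the set of copies opened in stage `t`: one copy is chosen in each
cluster, each unclustered copy `k` of the stage is opened with probability `ybar k`, and
all these choices are independent. -/
noncomputable def openProb (R : Run s γ K) (t : Option Ω) (O : Finset K) : ℝ :=
  ((R.clusters t).map fun C => R.clusterProb C O).prod *
    ∏ k ∈ R.copies t with ∀ C ∈ R.clusters t, k ∉ C,
      if k ∈ O then R.ybar k else 1 - R.ybar k

/-- The original facilities opened when the copies in `O` are opened. -/
def opened (R : Run s γ K) (O : Finset K) : Finset F := O.image R.parent

/-- The distance from client `j` to the closest facility in `G` (`0` if `G` is empty). -/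
noncomputable def connect (_R : Run s γ K) (G : Finset F) (j : D) : ℝ :=
  if h : G.Nonempty then G.inf' h (fun i => I.c i j) else 0

/-- The cost in scenario `A` when the copies in `O₁` are opened in Stage I, those in `O₂`
in Stage II, and each client of `A` is connected to the closest open facility. -/
noncomputable def cost (R : Run s γ K) (A : Ω) (O₁ O₂ : Finset K) : ℝ :=
  ∑ i ∈ R.opened O₁, I.f₁ i + ∑ i ∈ R.opened O₂, I.f₂ A i +
    ∑ j ∈ I.scenario A, R.connect (R.opened O₁ ∪ R.opened O₂) j

/-- The expected cost in scenario `A`; Stage I and Stage II use independent random choices. -/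
noncomputable def expectedCost (R : Run s γ K) (A : Ω) : ℝ :=
  ∑ O₁ ∈ (R.copies none).powerset, ∑ O₂ ∈ (R.copies (some A)).powerset,
    R.openProb none O₁ * R.openProb (some A) O₂ * R.cost A O₁ O₂

end Run

end

end StochFacLoc

/-! Opening costs follow from marginals: a copy opens with probability at most `ybar k`, and these
values add up to `γ` times the fractional openings. The work lies in the connection cost of one
client `j` of scenario `A`.

Let `m r` be the total `xbar`-weight, over both stages, of copies within distance `r` of `j`, and `M
≥ γ` its total. Independent openings miss all servers within `r` with probability at most `exp (-m
r)`; picking exactly one copy per cluster only helps, since `1 - a ≤ exp (-a)`. Let `d` be the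
smaller of the two candidate radii. The candidate of `j` meets a cluster of radius at most `d`, so
some copy within `3 * d` is always open (`Run.exists_radius`). Hence the expected connection cost is
at most the integral of `exp (-m r)` over `[0, 3 * d]`, while the integral of `M - m r` over the
same interval is at most `∑ c * xbar`, which is `γ` times the fractional connection cost.

It remains to compare the two integrals (`integral_exp_neg_le`). Below `d` each stage serves `j` to
an extent at most `1`, so `m ≤ 2`, and `exp (-m)` undercuts `M - m` by at least `0.3`. On the
remaining length `2 * d` it exceeds `M - m` by at most `exp (-2) ≤ 0.15`. Gain and loss balance.

A run exists because each scaled facility can be viewed as a half-line cut into short pieces, in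
which every prescribed amount is an initial segment (`exists_splitting`). -/

namespace StochFacLoc

/-! ### The random opening within one stage -/

section Dist
variable {K : Type*} [DecidableEq K]

/-- The probability that a random choice of one element of `C` with probabilities `y` yields
the set `O ∩ C`. -/
noncomputable def pickProb (y : K → ℝ) (C O : Finset K) : ℝ :=
  ∑ k ∈ C, if O ∩ C = {k} then y k else 0

/-- The elements of `T` that lie in no cluster. -/
def unclustered (Cs : List (Finset K)) (T : Finset K) : Finset K := {k ∈ T | ∀ C ∈ Cs, k ∉ C}

/-- The probability that `O` is the random set obtained from `T` by picking one element from each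
set in `Cs` and every other element independently, with probabilities `y`. -/
noncomputable def roundProb (y : K → ℝ) (Cs : List (Finset K)) (T O : Finset K) : ℝ :=
  (Cs.map fun C => pickProb y C O).prod *
    ∏ k ∈ unclustered Cs T, if k ∈ O then y k else 1 - y k

/-- The product of the escape probabilities of all independent choices, where `a` is the
probability of being caught. -/
noncomputable def escape (a : K → ℝ) (Cs : List (Finset K)) (T : Finset K) : ℝ :=
  (Cs.map fun C => 1 - ∑ k ∈ C, a k).prod * ∏ k ∈ unclustered Cs T, (1 - a k)

lemma unclustered_nil (T : Finset K) : unclustered [] T = T := by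
  simp [unclustered]

lemma unclustered_cons (C : Finset K) (Cs : List (Finset K)) (T : Finset K) :
    unclustered (C :: Cs) T = unclustered Cs (T \ C) := by
  ext k
  simp [unclustered, and_assoc]

lemma sum_powerset_split {C T : Finset K} (h : C ⊆ T) (f : Finset K → ℝ) :
    ∑ O ∈ T.powerset, f O = ∑ P ∈ C.powerset, ∑ Q ∈ (T \ C).powerset, f (P ∪ Q) := by
  rw [← Finset.sum_product']
  refine Finset.sum_bij' (fun O _ => (O ∩ C, O \ C)) (fun p _ => p.1 ∪ p.2) ?_ ?_ ?_ ?_ ?_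
  · intro O hO
    simp only [Finset.mem_product, Finset.mem_powerset] at hO ⊢
    exact ⟨Finset.inter_subset_right, Finset.sdiff_subset_sdiff hO subset_rfl⟩
  · intro p hp
    simp only [Finset.mem_product, Finset.mem_powerset] at hp ⊢
    exact Finset.union_subset (hp.1.trans h) (hp.2.trans Finset.sdiff_subset)
  · intro O _
    ext k; simp; tauto
  · rintro ⟨P, Q⟩ hp
    simp only [Finset.mem_product, Finset.mem_powerset] at hp
    have h1 := fun k => @hp.1 k
    have h2 := fun k => @hp.2 k
    simp only [Finset.mem_sdiff] at h2
    ext k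
    · have := h1 k; have := h2 k; simp; tauto
    · have := h1 k; have := h2 k; simp; tauto
  · intro O _
    congr 1
    ext k; simp; tauto

lemma sum_pickProb_mul {y φ : K → ℝ} {C : Finset K} :
    ∑ P ∈ C.powerset, pickProb y C P * ∏ k ∈ P, φ k = ∑ k ∈ C, y k * φ k := by
  simp only [pickProb, Finset.sum_mul]
  rw [Finset.sum_comm]
  refine Finset.sum_congr rfl fun k hk => ?_
  rw [Finset.sum_eq_single {k}]
  · simp [hk]
  · intro P hP hne
    rw [Finset.inter_eq_left.2 (Finset.mem_powerset.1 hP), if_neg hne, zero_mul]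
  · simp [hk]

lemma pickProb_congr {y : K → ℝ} {C O O' : Finset K} (h : O ∩ C = O' ∩ C) :
    pickProb y C O = pickProb y C O' := by
  simp [pickProb, h]

/-- The clusters partition part of `T`, and each carries total probability `1`. -/
structure IsClustering (y : K → ℝ) (Cs : List (Finset K)) (T : Finset K) : Prop where
  subset : ∀ C ∈ Cs, C ⊆ T
  disjoint : Cs.Pairwise Disjoint
  sum_eq_one : ∀ C ∈ Cs, ∑ k ∈ C, y k = 1

lemma IsClustering.tail {y : K → ℝ} {C : Finset K} {Cs : List (Finset K)} {T : Finset K}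
    (h : IsClustering y (C :: Cs) T) : IsClustering y Cs (T \ C) where
  subset B hB := by
    have h1 := h.subset B (List.mem_cons_of_mem _ hB)
    have h2 := (List.pairwise_cons.1 h.disjoint).1 B hB
    exact Finset.subset_sdiff.2 ⟨h1, h2.symm⟩
  disjoint := (List.pairwise_cons.1 h.disjoint).2
  sum_eq_one B hB := h.sum_eq_one B (List.mem_cons_of_mem _ hB)

/-- The generating function of the random set. -/
lemma sum_roundProb_mul {y : K → ℝ} (φ : K → ℝ) {Cs : List (Finset K)} {T : Finset K}
    (h : IsClustering y Cs T) :
    ∑ O ∈ T.powerset, roundProb y Cs T O * ∏ k ∈ O, φ k =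
      escape (fun k => y k * (1 - φ k)) Cs T := by
  induction Cs generalizing T with
  | nil =>
    simp only [roundProb, escape, unclustered_nil, List.map_nil, List.prod_nil, one_mul]
    -- Expanding the product of these binomials gives one term per set of opened elements.
    have : ∀ k, 1 - y k * (1 - φ k) = y k * φ k + (1 - y k) := fun k => by ring
    simp only [this]
    rw [Finset.prod_add]
    refine Finset.sum_congr rfl fun O hO => ?_
    have hO := Finset.mem_powerset.1 hO
    rw [← Finset.prod_sdiff hO, Finset.prod_mul_distrib]
    have e1 : ∏ k ∈ T \ O, (if k ∈ O then y k else 1 - y k) = ∏ k ∈ T \ O, (1 - y k) :=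
      Finset.prod_congr rfl fun k hk => if_neg (Finset.mem_sdiff.1 hk).2
    have e2 : ∏ k ∈ O, (if k ∈ O then y k else 1 - y k) = ∏ k ∈ O, y k :=
      Finset.prod_congr rfl fun k hk => if_pos hk
    rw [e1, e2]; ring
  | cons C Cs ih =>
    have hC : C ⊆ T := h.subset C List.mem_cons_self
    rw [sum_powerset_split hC]
    -- The choice in `C` is independent of the rest: the other clusters and the unclustered elements
    -- avoid `C`.
    have hsplit : ∀ P ∈ C.powerset, ∀ Q ∈ (T \ C).powerset,
        roundProb y (C :: Cs) T (P ∪ Q) * ∏ k ∈ P ∪ Q, φ k =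
          (pickProb y C P * ∏ k ∈ P, φ k) *
            (roundProb y Cs (T \ C) Q * ∏ k ∈ Q, φ k) := by
      intro P hP Q hQ
      rw [Finset.mem_powerset] at hP hQ
      have hQC : Disjoint Q C := (Finset.subset_sdiff.1 hQ).2
      have hPQ : Disjoint P Q := (hQC.mono_right hP).symm
      have e1 : pickProb y C (P ∪ Q) = pickProb y C P := pickProb_congr (by
        rw [Finset.union_inter_distrib_right, Finset.disjoint_iff_inter_eq_empty.1 hQC,
          Finset.union_empty])
      have e2 : Cs.map (fun B => pickProb y B (P ∪ Q)) = Cs.map (fun B => pickProb y B Q) := by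
        refine List.map_congr_left fun B hB => pickProb_congr ?_
        have hCB : Disjoint P B :=
          ((List.pairwise_cons.1 h.disjoint).1 B hB).mono_left hP
        rw [Finset.union_inter_distrib_right, Finset.disjoint_iff_inter_eq_empty.1 hCB,
          Finset.empty_union]
      have e3 : ∏ k ∈ unclustered Cs (T \ C), (if k ∈ P ∪ Q then y k else 1 - y k) =
          ∏ k ∈ unclustered Cs (T \ C), (if k ∈ Q then y k else 1 - y k) := by
        refine Finset.prod_congr rfl fun k hk => ?_
        have hk : k ∉ P := fun hkP =>
          (Finset.mem_sdiff.1 (Finset.mem_filter.1 hk).1).2 (hP hkP)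
        simp [hk]
      rw [Finset.prod_union hPQ]
      simp only [roundProb, List.map_cons, List.prod_cons, unclustered_cons, e1, e2, e3]
      ring
    rw [Finset.sum_congr rfl fun P hP => Finset.sum_congr rfl (hsplit P hP)]
    simp only [← Finset.mul_sum, ← Finset.sum_mul]
    rw [ih h.tail, sum_pickProb_mul]
    simp only [escape, List.map_cons, List.prod_cons, unclustered_cons, mul_sub, mul_one,
      Finset.sum_sub_distrib]
    rw [h.sum_eq_one C List.mem_cons_self]
    ring

lemma escape_zero (Cs : List (Finset K)) (T : Finset K) :
    escape (fun _ => 0) Cs T = 1 := by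
  simp [escape]

/-- Each independent choice contributes a factor `1 - p` with `0 ≤ p ≤ 1`. The upper bound is `1 - p
≤ exp (-p)`, the lower one the union bound; `a ≤ y` keeps `p ≤ 1` on a cluster. -/
lemma escape_bounds {y a : K → ℝ} {Cs : List (Finset K)} {T : Finset K}
    (h : IsClustering y Cs T) (h0 : ∀ k, 0 ≤ a k) (hy : ∀ k, a k ≤ y k) (h1 : ∀ k, a k ≤ 1) :
    0 ≤ escape a Cs T ∧ escape a Cs T ≤ Real.exp (-∑ k ∈ T, a k) ∧
      1 - ∑ k ∈ T, a k ≤ escape a Cs T := by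
  induction Cs generalizing T with
  | nil =>
    simp only [escape, unclustered_nil, List.map_nil, List.prod_nil, one_mul]
    refine ⟨Finset.prod_nonneg fun k _ => sub_nonneg.2 (h1 k), ?_, ?_⟩
    · rw [← Finset.sum_neg_distrib, Real.exp_sum]
      exact Finset.prod_le_prod (fun k _ => sub_nonneg.2 (h1 k))
        fun k _ => Real.one_sub_le_exp_neg _
    · clear h
      induction T using Finset.induction_on with
      | empty => simp
      | insert k T hk ih =>
        rw [Finset.prod_insert hk, Finset.sum_insert hk]
        have hp : ∏ i ∈ T, (1 - a i) ≤ 1 :=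
          Finset.prod_le_one (fun i _ => sub_nonneg.2 (h1 i)) fun i _ => sub_le_self _ (h0 i)
        nlinarith [h0 k, h1 k]
  | cons C Cs ih =>
    obtain ⟨i0, i1, i2⟩ := ih h.tail
    have hC : C ⊆ T := h.subset C List.mem_cons_self
    have hs : 0 ≤ ∑ k ∈ C, a k := Finset.sum_nonneg fun k _ => h0 k
    have hs1 : ∑ k ∈ C, a k ≤ 1 :=
      (Finset.sum_le_sum fun k _ => hy k).trans_eq (h.sum_eq_one C List.mem_cons_self)
    have e : escape a (C :: Cs) T = (1 - ∑ k ∈ C, a k) * escape a Cs (T \ C) := by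
      simp only [escape, List.map_cons, List.prod_cons, unclustered_cons, mul_assoc]
    rw [e, ← Finset.sum_sdiff hC]
    have hT : 0 ≤ ∑ k ∈ T \ C, a k := Finset.sum_nonneg fun k _ => h0 k
    have i3 : escape a Cs (T \ C) ≤ 1 := i1.trans (Real.exp_le_one_iff.2 (by linarith))
    refine ⟨mul_nonneg (by linarith) i0, ?_, by nlinarith⟩
    rw [neg_add, Real.exp_add, mul_comm]
    exact mul_le_mul i1 (Real.one_sub_le_exp_neg _) (by linarith) (Real.exp_pos _).le

variable {y : K → ℝ} {Cs : List (Finset K)} {T : Finset K}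

lemma pickProb_nonneg (h0 : ∀ k, 0 ≤ y k) (C O : Finset K) : 0 ≤ pickProb y C O :=
  Finset.sum_nonneg fun k _ => by split_ifs <;> simp [h0]

lemma roundProb_nonneg (h0 : ∀ k, 0 ≤ y k) (h1 : ∀ k, y k ≤ 1) (O : Finset K) :
    0 ≤ roundProb y Cs T O := by
  refine mul_nonneg (List.prod_nonneg ?_) (Finset.prod_nonneg fun k _ => ?_)
  · intro x hx
    obtain ⟨C, -, rfl⟩ := List.mem_map.1 hx
    exact pickProb_nonneg h0 C O
  · split_ifs
    · exact h0 k
    · exact sub_nonneg.2 (h1 k)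

lemma sum_roundProb (h : IsClustering y Cs T) : ∑ O ∈ T.powerset, roundProb y Cs T O = 1 := by
  have := sum_roundProb_mul (fun _ => 1) h
  simpa [escape_zero] using this

lemma exists_inter_eq_of_roundProb_pos {O : Finset K} (h : 0 < roundProb y Cs T O)
    {C : Finset K} (hC : C ∈ Cs) : ∃ k, O ∩ C = {k} := by
  by_contra! hne
  have h0 : pickProb y C O = 0 := Finset.sum_eq_zero fun k _ => if_neg (hne k)
  have : (Cs.map fun C => pickProb y C O).prod = 0 :=
    List.prod_eq_zero (List.mem_map.2 ⟨C, hC, h0⟩)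
  simp [roundProb, this] at h

lemma prod_avoid (S O : Finset K) :
    ∏ k ∈ O, (if k ∈ S then (0 : ℝ) else 1) = if Disjoint O S then 1 else 0 := by
  split_ifs with h
  · exact Finset.prod_eq_one fun k hk => if_neg (Finset.disjoint_left.1 h hk)
  · obtain ⟨k, hk, hk'⟩ := Finset.not_disjoint_iff.1 h
    exact Finset.prod_eq_zero hk (if_pos hk')

/-- The generating function at the indicator of the complement of `S` is the probability of opening
nothing in `S`. The upper bound serves connection costs, the lower one opening probabilities. -/
lemma sum_roundProb_avoid (h : IsClustering y Cs T) (h0 : ∀ k, 0 ≤ y k) (h1 : ∀ k, y k ≤ 1)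
    {S : Finset K} (hS : S ⊆ T) :
    ∑ O ∈ T.powerset, roundProb y Cs T O * (if Disjoint O S then 1 else 0) ≤
        Real.exp (-∑ k ∈ S, y k) ∧
    1 - ∑ k ∈ S, y k ≤
      ∑ O ∈ T.powerset, roundProb y Cs T O * (if Disjoint O S then 1 else 0) := by
  simp only [← prod_avoid]
  rw [sum_roundProb_mul _ h]
  have ha : ∀ k, y k * (1 - if k ∈ S then (0 : ℝ) else 1) = if k ∈ S then y k else 0 := by
    intro k; split_ifs <;> simp
  simp only [ha]
  have hb := escape_bounds (a := fun k => if k ∈ S then y k else 0) h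
    (fun k => by split_ifs <;> simp [h0])
    (fun k => by split_ifs <;> simp [h0])
    (fun k => by split_ifs <;> simp [h1])
  have hs : ∑ k ∈ T, (if k ∈ S then y k else 0) = ∑ k ∈ S, y k := by
    rw [← Finset.sum_filter, Finset.filter_mem_eq_inter, Finset.inter_eq_right.2 hS]
  rw [hs] at hb
  exact hb.2

/-- An element is chosen with probability at most its weight. -/
lemma sum_roundProb_mem_le (h : IsClustering y Cs T) (h0 : ∀ k, 0 ≤ y k) (h1 : ∀ k, y k ≤ 1)
    {k : K} (hk : k ∈ T) :
    ∑ O ∈ T.powerset, roundProb y Cs T O * (if k ∈ O then 1 else 0) ≤ y k := by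
  have h2 := (sum_roundProb_avoid h h0 h1 (Finset.singleton_subset_iff.2 hk)).2
  have h3 : ∑ O ∈ T.powerset, roundProb y Cs T O * (if k ∈ O then 1 else 0) =
      ∑ O ∈ T.powerset, roundProb y Cs T O -
        ∑ O ∈ T.powerset, roundProb y Cs T O * (if Disjoint O {k} then 1 else 0) := by
    rw [← Finset.sum_sub_distrib]
    refine Finset.sum_congr rfl fun O _ => ?_
    by_cases hO : k ∈ O <;> simp [hO]
  rw [h3, sum_roundProb h]
  simp only [Finset.sum_singleton] at h2
  linarith

end Dist

/-! ### Greedy clustering -/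

section Greedy
variable {K : Type*} [DecidableEq K]

lemma greedy_append_singleton (l : List (Finset K)) (C : Finset K) :
    greedy (l ++ [C]) = if ∀ B ∈ greedy l, Disjoint C B then C :: greedy l else greedy l := by
  unfold greedy
  rw [List.foldl_append]
  rfl

lemma mem_of_mem_greedy {l : List (Finset K)} {C : Finset K} (h : C ∈ greedy l) : C ∈ l := by
  induction l using List.reverseRecOn with
  | nil => simp [greedy] at h
  | append_singleton l B ih =>
    rw [greedy_append_singleton] at h
    split_ifs at h
    · rcases List.mem_cons.1 h with rfl | h
      · simp
      · simp [ih h]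
    · simp [ih h]

lemma greedy_pairwise_disjoint (l : List (Finset K)) : (greedy l).Pairwise Disjoint := by
  induction l using List.reverseRecOn with
  | nil => simp [greedy]
  | append_singleton l B ih =>
    rw [greedy_append_singleton]
    split_ifs with h
    · exact List.pairwise_cons.2 ⟨h, ih⟩
    · exact ih

/-- Every scanned set meets a cluster that was scanned no later. -/
lemma exists_mem_greedy_not_disjoint {α β : Type*} [Preorder β] (f : α → Finset K) (d : α → β)
    {l : List α} (hl : l.Pairwise fun p q => d p ≤ d q) {x : α} (hx : x ∈ l)
    (hne : (f x).Nonempty) :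
    ∃ p ∈ l, f p ∈ greedy (l.map f) ∧ ¬ Disjoint (f x) (f p) ∧ d p ≤ d x := by
  induction l using List.reverseRecOn with
  | nil => simp at hx
  | append_singleton l z ih =>
    obtain ⟨h1, -, h2⟩ := List.pairwise_append.1 hl
    have hmono : ∀ B ∈ greedy (l.map f), B ∈ greedy ((l ++ [z]).map f) := by
      intro B hB
      rw [List.map_append, List.map_singleton, greedy_append_singleton]
      split_ifs
      · exact List.mem_cons_of_mem _ hB
      · exact hB
    rcases List.mem_append.1 hx with hx | hx
    · obtain ⟨p, hp, hpg, hd, hle⟩ := ih h1 hx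
      exact ⟨p, by simp [hp], hmono _ hpg, hd, hle⟩
    · obtain rfl : x = z := by simpa using hx
      by_cases hdis : ∀ B ∈ greedy (l.map f), Disjoint (f x) B
      · refine ⟨x, by simp, ?_, by simpa using hne.ne_empty, le_rfl⟩
        rw [List.map_append, List.map_singleton, greedy_append_singleton, if_pos hdis]
        simp
      · push Not at hdis
        obtain ⟨B, hB, hd⟩ := hdis
        obtain ⟨p, hp, rfl⟩ := List.mem_map.1 (mem_of_mem_greedy hB)
        exact ⟨p, by simp [hp], hmono _ hB, hd, h2 p hp x (by simp)⟩

end Greedy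

/-! ### Comparison of integrals and the connection cost of one client -/

section Integral
open intervalIntegral
open MeasureTheory (volume)

/-- The function `exp (-t) + t` has derivative `1 - exp (-t) ≥ 0` for `t ≥ 0`. -/
lemma exp_neg_add_self_le {a b : ℝ} (ha : 0 ≤ a) (hab : a ≤ b) :
    Real.exp (-a) + a ≤ Real.exp (-b) + b := by
  have h1 : Real.exp (-b) = Real.exp (-a) * Real.exp (a - b) := by
    rw [← Real.exp_add]; ring_nf
  have h2 := Real.add_one_le_exp (a - b)
  have h3 : Real.exp (-a) ≤ 1 := Real.exp_le_one_iff.2 (by linarith)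
  have h4 := Real.exp_pos (-a)
  nlinarith

lemma exp_neg_two_le : Real.exp (-2) ≤ 0.15 := by
  have h := Real.exp_one_gt_d9
  have h2 : Real.exp (-2) * (Real.exp 1 * Real.exp 1) = 1 := by
    rw [← Real.exp_add, ← Real.exp_add]; norm_num
  have h3 := Real.exp_pos (-2)
  nlinarith [mul_pos h3 (Real.exp_pos 1)]

lemma integral_exp_neg_le {m : ℝ → ℝ} (hm : Monotone m) (h0 : ∀ r, 0 ≤ m r) {M d : ℝ}
    (hM : 2.4957 ≤ M) (hmM : ∀ r, m r ≤ M) (hd : 0 ≤ d) (hmd : ∀ r < d, m r ≤ 2) :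
    ∫ r in (0 : ℝ)..3 * d, Real.exp (-m r) ≤ ∫ r in (0 : ℝ)..3 * d, (M - m r) := by
  have hanti : Antitone fun r => Real.exp (-m r) := fun a b h =>
    Real.exp_le_exp.2 (neg_le_neg (hm h))
  have hanti' : Antitone fun r => M - m r := fun a b h => sub_le_sub_left (hm h) _
  have he := exp_neg_two_le
  have i1 : ∀ a b : ℝ, IntervalIntegrable (fun r => Real.exp (-m r) - (M - m r)) volume a b :=
    fun a b => hanti.intervalIntegrable.sub hanti'.intervalIntegrable
  have hsplit := integral_add_adjacent_intervals (i1 0 d) (i1 d (3 * d))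
  -- Here `m ≤ 2`, so `exp (-m) + m - M ≤ 0.15 + 2 - 2.4957 ≤ -0.3`.
  have hA : ∫ r in (0 : ℝ)..d, (Real.exp (-m r) - (M - m r)) ≤ ∫ _ in (0 : ℝ)..d, (-0.3 : ℝ) := by
    refine integral_mono_on_of_le_Ioo hd (i1 _ _) intervalIntegrable_const fun r hr => ?_
    have := exp_neg_add_self_le (h0 r) (hmd r hr.2)
    linarith
  -- Only `m ≤ M` is known here, which leaves an excess of `exp (-M)`. The two bounds add up to
  -- `-0.3 * d + 0.15 * (2 * d) = 0`.
  have hB : ∫ r in d..3 * d, (Real.exp (-m r) - (M - m r)) ≤ ∫ _ in d..3 * d, (0.15 : ℝ) := by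
    refine integral_mono_on_of_le_Ioo (by linarith) (i1 _ _) intervalIntegrable_const
      fun r hr => ?_
    have h1 := exp_neg_add_self_le (h0 r) (hmM r)
    have h2 : Real.exp (-M) ≤ Real.exp (-2) := Real.exp_le_exp.2 (by linarith)
    linarith
  rw [integral_const, smul_eq_mul] at hA hB
  rw [← sub_nonpos, ← integral_sub hanti.intervalIntegrable hanti'.intervalIntegrable, ← hsplit]
  linarith

/-- The integrands are step functions; monotonicity supplies their integrability. -/
lemma antitone_not_le (c : ℝ) : Antitone fun r : ℝ => if c ≤ r then (0 : ℝ) else 1 := by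
  intro a b h
  dsimp only
  split_ifs with h1 h2
  · exact le_rfl
  · exact zero_le_one
  · exact absurd (‹c ≤ a›.trans h) h1
  · exact le_rfl

lemma integral_not_le_le {c D : ℝ} (hc : 0 ≤ c) (hD : 0 ≤ D) :
    ∫ r in (0 : ℝ)..D, (if c ≤ r then (0 : ℝ) else 1) ≤ c := by
  have key : ∀ b, 0 ≤ b → ∫ r in (0 : ℝ)..b, (if c ≤ r then (0 : ℝ) else 1) ≤ b := by
    intro b hb
    have := integral_mono_on_of_le_Ioo hb (antitone_not_le c).intervalIntegrable
      (intervalIntegrable_const (c := (1 : ℝ)) (μ := volume))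
      fun r _ => by split_ifs <;> norm_num
    simpa using this
  rcases le_total D c with h | h
  · exact (key D hD).trans h
  · rw [← integral_add_adjacent_intervals (b := c) (antitone_not_le c).intervalIntegrable
      (antitone_not_le c).intervalIntegrable]
    have h0 : ∫ r in c..D, (if c ≤ r then (0 : ℝ) else 1) ≤ ∫ _ in c..D, (0 : ℝ) :=
      integral_mono_on_of_le_Ioo h (antitone_not_le c).intervalIntegrable
        intervalIntegrable_const fun r hr => by rw [if_pos hr.1.le]
    have := key c hc
    simp only [integral_zero] at h0
    linarith

lemma le_integral_of_one_le {f : ℝ → ℝ} (hf : Antitone f) (h0 : ∀ r, 0 ≤ f r) {κ D : ℝ}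
    (hκ : 0 ≤ κ) (hD : κ ≤ D) (h1 : ∀ r < κ, 1 ≤ f r) : κ ≤ ∫ r in (0 : ℝ)..D, f r := by
  rw [← integral_add_adjacent_intervals (b := κ) hf.intervalIntegrable hf.intervalIntegrable]
  have i1 := integral_mono_on_of_le_Ioo hκ
      (intervalIntegrable_const (c := (1 : ℝ)) (μ := volume)) hf.intervalIntegrable
      fun r hr => h1 r hr.2
  have i2 : 0 ≤ ∫ r in κ..D, f r := integral_nonneg hD fun r _ => h0 r
  simp only [integral_const, sub_zero, smul_eq_mul, mul_one] at i1
  linarith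

variable {K : Type*} [DecidableEq K]

lemma antitone_disjoint {S : ℝ → Finset K} (hS : Monotone S) (O : Finset K) :
    Antitone fun r => if Disjoint O (S r) then (1 : ℝ) else 0 := by
  intro a b h
  dsimp only
  split_ifs with h1 h2
  · exact le_rfl
  · exact absurd (h1.mono_right (hS h)) h2
  · exact zero_le_one
  · exact le_rfl

/-- The expected connection cost under two independent roundings, where some element at distance
at most `3 * d` is always chosen and the servers at distance less than `d` have total weight at
most `2`. -/
lemma sum_connection_le {y x c : K → ℝ} {Cs₁ Cs₂ : List (Finset K)} {T₁ T₂ : Finset K}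
    (h₁ : IsClustering y Cs₁ T₁) (h₂ : IsClustering y Cs₂ T₂)
    (y0 : ∀ k, 0 ≤ y k) (y1 : ∀ k, y k ≤ 1) (hx : ∀ k, x k = 0 ∨ x k = y k)
    (hc : ∀ k, 0 ≤ c k) {d : ℝ} (hd : 0 ≤ d)
    (hM : 2.4957 ≤ ∑ k ∈ T₁, x k + ∑ k ∈ T₂, x k)
    (hnear : ∀ r < d, ∑ k ∈ T₁ with c k ≤ r, x k + ∑ k ∈ T₂ with c k ≤ r, x k ≤ 2)
    {κ : Finset K → Finset K → ℝ} (κ0 : ∀ O₁ O₂, 0 ≤ κ O₁ O₂)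
    (hκ : ∀ O₁ O₂, ∀ k ∈ O₁ ∪ O₂, κ O₁ O₂ ≤ c k)
    (hfar : ∀ O₁ O₂, 0 < roundProb y Cs₁ T₁ O₁ → 0 < roundProb y Cs₂ T₂ O₂ → κ O₁ O₂ ≤ 3 * d) :
    ∑ O₁ ∈ T₁.powerset, ∑ O₂ ∈ T₂.powerset,
        roundProb y Cs₁ T₁ O₁ * roundProb y Cs₂ T₂ O₂ * κ O₁ O₂ ≤
      ∑ k ∈ T₁, c k * x k + ∑ k ∈ T₂, c k * x k := by
  have x0 : ∀ k, 0 ≤ x k := fun k => by rcases hx k with h | h <;> simp [h, y0]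
  -- Keeping only elements with `x k ≠ 0` makes `x` and `y` agree on `S`, so its opening weight is
  -- `m`.
  set S : Finset K → ℝ → Finset K := fun T r => T.filter fun k => c k ≤ r ∧ x k ≠ 0 with hSdef
  set m : Finset K → ℝ → ℝ := fun T r => ∑ k ∈ T with c k ≤ r, x k with hmdef
  have hS : ∀ T, Monotone (S T) := fun T a b h k hk => by
    simp only [hSdef, Finset.mem_filter] at hk ⊢
    exact ⟨hk.1, hk.2.1.trans h, hk.2.2⟩
  have hSm : ∀ T r, ∑ k ∈ S T r, y k = m T r := by
    intro T r
    simp only [hSdef, hmdef]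
    rw [← Finset.filter_filter, ← Finset.sum_filter_ne_zero (f := x)]
    refine Finset.sum_congr rfl fun k hk => ?_
    exact ((hx k).resolve_left (Finset.mem_filter.1 hk).2).symm
  have hm : ∀ T, Monotone (m T) := fun T a b h =>
    Finset.sum_le_sum_of_subset_of_nonneg
      (fun k hk => by
        simp only [Finset.mem_filter] at hk ⊢
        exact ⟨hk.1, hk.2.trans h⟩) fun k _ _ => x0 k
  have hm0 : ∀ T r, 0 ≤ m T r := fun T r => Finset.sum_nonneg fun k _ => x0 k
  have hmT : ∀ T r, m T r ≤ ∑ k ∈ T, x k := fun T r =>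
    Finset.sum_le_sum_of_subset_of_nonneg (Finset.filter_subset _ _) fun k _ _ => x0 k
  set N : Finset K → Finset K → ℝ → ℝ := fun T O r => if Disjoint O (S T r) then 1 else 0
    with hNdef
  have hN : ∀ T O, Antitone (N T O) := fun T O => antitone_disjoint (hS T) O
  have hN0 : ∀ T O r, 0 ≤ N T O r := fun T O r => by simp only [hNdef]; split_ifs <;> norm_num
  have hNN : ∀ O₁ O₂, Antitone fun r => N T₁ O₁ r * N T₂ O₂ r := fun O₁ O₂ a b h =>
    mul_le_mul (hN _ _ h) (hN _ _ h) (hN0 _ _ _) (hN0 _ _ _)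
  set p := roundProb y Cs₁ T₁ with hp
  set q := roundProb y Cs₂ T₂ with hq
  have p0 : ∀ O, 0 ≤ p O := roundProb_nonneg y0 y1
  have q0 : ∀ O, 0 ≤ q O := roundProb_nonneg y0 y1
  calc ∑ O₁ ∈ T₁.powerset, ∑ O₂ ∈ T₂.powerset, p O₁ * q O₂ * κ O₁ O₂
      ≤ ∑ O₁ ∈ T₁.powerset, ∑ O₂ ∈ T₂.powerset,
          ∫ r in (0 : ℝ)..3 * d, p O₁ * q O₂ * (N T₁ O₁ r * N T₂ O₂ r) := by
        refine Finset.sum_le_sum fun O₁ _ => Finset.sum_le_sum fun O₂ _ => ?_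
        rw [integral_const_mul]
        rcases (p0 O₁).eq_or_lt with hp0 | hp0
        · simp [← hp0]
        rcases (q0 O₂).eq_or_lt with hq0 | hq0
        · simp [← hq0]
        refine mul_le_mul_of_nonneg_left ?_ (mul_nonneg (p0 _) (q0 _))
        refine le_integral_of_one_le (hNN O₁ O₂) (fun r => mul_nonneg (hN0 _ _ _) (hN0 _ _ _))
          (κ0 _ _) (hfar _ _ hp0 hq0) fun r hr => ?_
        -- At a radius `r` below the connection cost no open element lies within `r`, so both
        -- avoidance indicators are `1`.
        have hdis : ∀ T O, O ⊆ O₁ ∪ O₂ → N T O r = 1 := by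
          intro T O hO
          refine if_pos (Finset.disjoint_left.2 fun k hk hkS => ?_)
          have := hκ O₁ O₂ k (hO hk)
          have := (Finset.mem_filter.1 hkS).2.1
          linarith
        rw [hdis T₁ O₁ Finset.subset_union_left, hdis T₂ O₂ Finset.subset_union_right]
        norm_num
    _ = ∫ r in (0 : ℝ)..3 * d,
          (∑ O₁ ∈ T₁.powerset, p O₁ * N T₁ O₁ r) * ∑ O₂ ∈ T₂.powerset, q O₂ * N T₂ O₂ r := by
        have hint : ∀ O₁ O₂, IntervalIntegrable
            (fun r => p O₁ * q O₂ * (N T₁ O₁ r * N T₂ O₂ r)) volume 0 (3 * d) :=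
          fun O₁ O₂ => (hNN O₁ O₂).intervalIntegrable.const_mul _
        rw [← Finset.sum_congr rfl fun O₁ _ => integral_finsetSum fun O₂ _ => hint O₁ O₂]
        rw [← integral_finsetSum fun O₁ _ => by
          simpa only [Finset.sum_fn] using
            IntervalIntegrable.sum T₂.powerset fun O₂ _ => hint O₁ O₂]
        congr 1
        ext r
        rw [Finset.sum_mul_sum]
        exact Finset.sum_congr rfl fun _ _ => Finset.sum_congr rfl fun _ _ => by ring
    _ ≤ ∫ r in (0 : ℝ)..3 * d, Real.exp (-(m T₁ r + m T₂ r)) := by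
        have hanti : ∀ (T : Finset K) (w : Finset K → ℝ), (∀ O, 0 ≤ w O) →
            Antitone fun r => ∑ O ∈ T.powerset, w O * N T O r := fun T w hw a b h =>
          Finset.sum_le_sum fun O _ => mul_le_mul_of_nonneg_left (hN T O h) (hw O)
        have hpos : ∀ (T : Finset K) (w : Finset K → ℝ), (∀ O, 0 ≤ w O) → ∀ r,
            0 ≤ ∑ O ∈ T.powerset, w O * N T O r := fun T w hw r =>
          Finset.sum_nonneg fun O _ => mul_nonneg (hw O) (hN0 _ _ _)
        refine integral_mono_on_of_le_Ioo (by linarith) (Antitone.intervalIntegrable ?_)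
          (Antitone.intervalIntegrable ?_) fun r _ => ?_
        · exact fun a b h => mul_le_mul (hanti T₁ p p0 h) (hanti T₂ q q0 h) (hpos _ _ q0 _)
            (hpos _ _ p0 _)
        · exact fun a b h => Real.exp_le_exp.2 (neg_le_neg (add_le_add (hm _ h) (hm _ h)))
        · rw [neg_add, Real.exp_add, ← hSm, ← hSm]
          exact mul_le_mul (sum_roundProb_avoid h₁ y0 y1 (Finset.filter_subset _ _)).1
            (sum_roundProb_avoid h₂ y0 y1 (Finset.filter_subset _ _)).1 (hpos _ _ q0 _)
            (Real.exp_pos _).le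
    _ ≤ ∫ r in (0 : ℝ)..3 * d, ((∑ k ∈ T₁, x k + ∑ k ∈ T₂, x k) - (m T₁ r + m T₂ r)) :=
        integral_exp_neg_le (fun a b h => add_le_add (hm _ h) (hm _ h))
          (fun r => add_nonneg (hm0 _ _) (hm0 _ _)) hM
          (fun r => add_le_add (hmT _ _) (hmT _ _)) hd hnear
    -- Layer-cake formula: `M - m r` is the weight beyond `r`, so element `k` contributes `x k`
    -- exactly while `r < c k`.
    _ = ∑ k ∈ T₁, x k * (∫ r in (0 : ℝ)..3 * d, (if c k ≤ r then (0 : ℝ) else 1)) +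
          ∑ k ∈ T₂, x k * (∫ r in (0 : ℝ)..3 * d, (if c k ≤ r then (0 : ℝ) else 1)) := by
        have hint : ∀ k, IntervalIntegrable (fun r => x k * if c k ≤ r then (0 : ℝ) else 1)
            volume 0 (3 * d) := fun k => (antitone_not_le _).intervalIntegrable.const_mul _
        simp only [← integral_const_mul]
        rw [← integral_finsetSum fun k _ => hint k, ← integral_finsetSum fun k _ => hint k,
          ← integral_add]
        · congr 1
          ext r
          have : ∀ T : Finset K, ∑ k ∈ T, (x k * if c k ≤ r then (0 : ℝ) else 1) =
              ∑ k ∈ T, x k - m T r := by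
            intro T
            simp only [hmdef, Finset.sum_filter]
            rw [← Finset.sum_sub_distrib]
            exact Finset.sum_congr rfl fun k _ => by split_ifs <;> simp
          rw [this, this]; ring
        all_goals
          simpa only [Finset.sum_fn] using IntervalIntegrable.sum _ fun k _ => hint k
    _ ≤ _ := by
        refine add_le_add (Finset.sum_le_sum fun k _ => ?_) (Finset.sum_le_sum fun k _ => ?_)
        all_goals
          rw [mul_comm (c k)]
          exact mul_le_mul_of_nonneg_left (integral_not_le_le (hc k) (by linarith)) (x0 k)

end Integral

/-! ### Splittings, candidate sets and the fallback copy -/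

section Splitting
variable {F D Ω X : Type*} [PseudoMetricSpace X]

lemma Inst.c_nonneg (I : Inst F D Ω X) (i : F) (j : D) : 0 ≤ I.c i j := dist_nonneg

variable [Fintype F] {I : Inst F D Ω X} {s : FracSol I}

lemma FracSol.x₁_add_x₂ (s : FracSol I) {A : Ω} {j : D} (hj : j ∈ I.scenario A) (i : F) :
    s.x₁ A i j + s.x₂ A i j = s.x A i j := by
  have h1 := s.y₁_nonneg i
  have h2 := s.y₂_nonneg A i
  have h3 := s.x_nonneg A i j hj
  have h4 := s.x_le A i j hj
  rw [FracSol.x₁, FracSol.x₂, ← mul_add, ← add_div]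
  rcases eq_or_ne (s.y₁ i + s.y₂ A i) 0 with h | h
  · have : s.x A i j = 0 := by linarith
    simp [this]
  · rw [div_self h, mul_one]

variable [DecidableEq F] [DecidableEq Ω] {γ : ℝ} {K : Type*} [Fintype K] (S : Splitting s γ K)

namespace Splitting

lemma mem_copies {t : Option Ω} {k : K} : k ∈ S.copies t ↔ S.stage k = t := by
  simp [copies]

/-- The weight `g` depends only on the original facility, so it factors out of each group of copies;
it will be an opening cost or a distance. -/
lemma sum_copies (t : Option Ω) (g : F → ℝ) (f : K → ℝ) :
    ∑ k ∈ S.copies t, g (S.parent k) * f k =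
      ∑ i, g i * ∑ k with S.parent k = i ∧ S.stage k = t, f k := by
  rw [← Finset.sum_fiberwise (S.copies t) S.parent]
  refine Finset.sum_congr rfl fun i _ => ?_
  rw [Finset.mul_sum, copies, Finset.filter_filter]
  simp only [and_comm (a := S.stage _ = t)]
  refine Finset.sum_congr rfl fun k hk => ?_
  rw [(Finset.mem_filter.1 hk).2.1]

lemma sum_mul_xbar {A : Ω} {j : D} (hj : j ∈ I.scenario A) (g : F → ℝ) :
    ∑ k ∈ S.copies none, g (S.parent k) * S.xbar A k j +
        ∑ k ∈ S.copies (some A), g (S.parent k) * S.xbar A k j =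
      γ * ∑ i, g i * s.x A i j := by
  rw [S.sum_copies none g (fun k => S.xbar A k j), S.sum_copies (some A) g (fun k => S.xbar A k j),
    ← Finset.sum_add_distrib, Finset.mul_sum]
  refine Finset.sum_congr rfl fun i _ => ?_
  rw [S.sum_xbar₁ A i j hj, S.sum_xbar₂ A i j hj, ← s.x₁_add_x₂ hj]
  ring

lemma le_sum_xbar (hγ : 0 ≤ γ) {A : Ω} {j : D} (hj : j ∈ I.scenario A) :
    γ ≤ ∑ k ∈ S.copies none, S.xbar A k j + ∑ k ∈ S.copies (some A), S.xbar A k j := by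
  have h := S.sum_mul_xbar hj fun _ => 1
  simp only [one_mul] at h
  rw [h]
  exact le_mul_of_one_le_right hγ (s.assign A j hj)

lemma xbar_nonneg {A : Ω} {j : D} (hj : j ∈ I.scenario A) (k : K) : 0 ≤ S.xbar A k j := by
  rcases S.xbar_eq A k j hj with h | h
  · exact h.ge
  · exact h ▸ S.ybar_nonneg k

lemma maxDist_eq_top_iff {j : D} {G : Finset K} : S.maxDist j G = ⊤ ↔ G = ∅ := by
  unfold maxDist
  split_ifs with h
  · simp [h.ne_empty]
  · simp [Finset.not_nonempty_iff_eq_empty.1 h]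

lemma exists_maxDist_eq {j : D} {G : Finset K} (h : G.Nonempty) :
    ∃ d : ℝ, S.maxDist j G = d ∧ 0 ≤ d ∧ ∀ k ∈ G, I.c (S.parent k) j ≤ d := by
  refine ⟨_, dif_pos h, ?_, fun k hk => Finset.le_sup' (fun k => I.c (S.parent k) j) hk⟩
  obtain ⟨k, hk⟩ := h
  exact (I.c_nonneg _ _).trans (Finset.le_sup' (fun k => I.c (S.parent k) j) hk)

lemma maxDist_le_iff {j : D} {G : Finset K} (h : G.Nonempty) {r : ℝ} :
    S.maxDist j G ≤ r ↔ ∀ k ∈ G, I.c (S.parent k) j ≤ r := by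
  rw [maxDist, dif_pos h, WithTop.coe_le_coe, Finset.sup'_le_iff]

variable {S} {t : Option Ω} {A : Ω} {j : D} {G : Finset K}

lemma IsCandidate.nonempty (h : S.IsCandidate t A j G)
    (h1 : 1 ≤ ∑ k ∈ S.copies t, S.xbar A k j) : G.Nonempty := by
  rw [Finset.nonempty_iff_ne_empty]
  rintro rfl
  simpa using (h.2 h1).2.2.1

lemma IsCandidate.one_le (h : S.IsCandidate t A j G) (hG : G.Nonempty) :
    1 ≤ ∑ k ∈ S.copies t, S.xbar A k j := by
  by_contra! hlt
  exact hG.ne_empty (h.1 hlt)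

lemma IsCandidate.subset (h : S.IsCandidate t A j G) : G ⊆ S.copies t := by
  rcases G.eq_empty_or_nonempty with rfl | hG
  · exact Finset.empty_subset _
  · exact (h.2 (h.one_le hG)).1

lemma IsCandidate.sum_ybar (h : S.IsCandidate t A j G) (hj : j ∈ I.scenario A)
    (hG : G.Nonempty) : ∑ k ∈ G, S.ybar k = 1 := by
  obtain ⟨-, hpos, hsum, -⟩ := h.2 (h.one_le hG)
  rw [← hsum]
  exact Finset.sum_congr rfl fun k hk =>
    ((S.xbar_eq A k j hj).resolve_left (hpos k hk).ne').symm

/-- Below the radius of the candidate set, the pair is served to an extent less than `1`. -/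
lemma IsCandidate.sum_near_le (h : S.IsCandidate t A j G) (hj : j ∈ I.scenario A) {r : ℝ}
    (hr : (r : WithTop ℝ) < S.maxDist j G) :
    ∑ k ∈ S.copies t with I.c (S.parent k) j ≤ r, S.xbar A k j ≤ 1 := by
  by_contra! hgt
  have hsub : {k ∈ S.copies t | I.c (S.parent k) j ≤ r} ⊆ S.copies t := Finset.filter_subset _ _
  have h1 := Finset.sum_le_sum_of_subset_of_nonneg hsub
    fun k _ _ => S.xbar_nonneg hj k
  have hmin := (h.2 (hgt.le.trans h1)).2.2.2 _ hsub hgt.le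
  have hne : ({k ∈ S.copies t | I.c (S.parent k) j ≤ r}).Nonempty := by
    rw [Finset.nonempty_iff_ne_empty]
    intro he
    rw [he] at hgt
    simp at hgt
    linarith
  exact (hr.trans_le hmin).not_ge
    ((S.maxDist_le_iff hne).2 fun k hk => (Finset.mem_filter.1 hk).2)

/-- One of the two candidate sets of a pair is non-empty if its total service is at least `2`. -/
lemma exists_candidate_nonempty {G₁ G₂ : Finset K} (hγ : 2 ≤ γ) (hj : j ∈ I.scenario A)
    (h₁ : S.IsCandidate none A j G₁) (h₂ : S.IsCandidate (some A) A j G₂) :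
    min (S.maxDist j G₁) (S.maxDist j G₂) < ⊤ := by
  have hM := S.le_sum_xbar (by linarith) hj
  rcases le_or_gt 1 (∑ k ∈ S.copies none, S.xbar A k j) with h | h
  · have := (S.maxDist_eq_top_iff (j := j)).not.2 (h₁.nonempty h).ne_empty
    exact (min_le_left _ _).trans_lt (lt_top_iff_ne_top.2 this)
  -- A total of at least `2` with less than `1` in Stage I leaves more than `1` for Stage II.
  · have := (S.maxDist_eq_top_iff (j := j)).not.2 (h₂.nonempty (by linarith)).ne_empty
    exact (min_le_right _ _).trans_lt (lt_top_iff_ne_top.2 this)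

lemma nonempty_of_maxDist_lt_top (h : S.maxDist j G < ⊤) : G.Nonempty := by
  rw [Finset.nonempty_iff_ne_empty]
  exact fun he => h.ne (S.maxDist_eq_top_iff.2 he)

lemma dist_parent_le (S : Splitting s γ K) (k k' : K) (j j' : D) :
    I.c (S.parent k') j ≤
      I.c (S.parent k') j' + I.c (S.parent k) j' + I.c (S.parent k) j := by
  unfold Inst.c
  have h1 := dist_triangle (I.facility (S.parent k')) (I.client j') (I.client j)
  have h2 := dist_triangle_left (I.client j') (I.client j) (I.facility (S.parent k))
  linarith

/-- Greedy clustering provides each scanned pair with a fallback within three times its radius. -/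
lemma exists_fallback [DecidableEq K] (S : Splitting s γ K) {α : Type*} {l : List α}
    {f : α → Finset K} {g : α → D}
    (hl : l.Pairwise fun p q => S.maxDist (g p) (f p) ≤ S.maxDist (g q) (f q)) {x : α}
    (hx : x ∈ l) (hne : (f x).Nonempty) {d : ℝ} (hd : S.maxDist (g x) (f x) = d) {O : Finset K}
    (hO : ∀ C ∈ greedy (l.map f), ∃ k, O ∩ C = {k}) :
    ∃ k ∈ O, I.c (S.parent k) (g x) ≤ 3 * d := by
  -- The candidate of `x` shares a copy `k` with the cluster of `p`, whose radius is at most `d`,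
  -- and `k'` is the copy opened there. The path from `k'` to `g p` to `k` to `g x` has three legs
  -- of length at most `d`.
  obtain ⟨p, -, hp, hdis, hle⟩ :=
    exists_mem_greedy_not_disjoint f (fun p => S.maxDist (g p) (f p)) hl hx hne
  obtain ⟨k, hkx, hkp⟩ := Finset.not_disjoint_iff.1 hdis
  obtain ⟨k', hk'⟩ := hO _ hp
  have hk' : k' ∈ O ∩ f p := hk' ▸ Finset.mem_singleton_self k'
  rw [Finset.mem_inter] at hk'
  refine ⟨k', hk'.1, ?_⟩
  rw [hd] at hle
  have h1 := (S.maxDist_le_iff ⟨k, hkp⟩).1 hle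
  have h2 := (S.maxDist_le_iff hne).1 hd.le
  have := S.dist_parent_le k k' (g x) (g p)
  linarith [h1 k hkp, h1 k' hk'.2, h2 k hkx]

end Splitting

end Splitting

/-! ### Expected costs of a run -/

namespace Run
variable {F D Ω X : Type*} [PseudoMetricSpace X] [Fintype F] {I : Inst F D Ω X} {s : FracSol I}
  [DecidableEq F] [DecidableEq Ω] {γ : ℝ} {K : Type*} [Fintype K]
  (R : Run s γ K)

/-- A first-stage pair satisfies only `d¹ ≤ d²`, which allows both radii to be `⊤`; the total
service `γ ≥ 2` excludes this. For second-stage pairs the strict inequality suffices. -/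
lemma cand₁_nonempty (hγ : 2 ≤ γ) {p : Ω × D} (hp : p ∈ R.order₁) :
    (R.cand₁ p.1 p.2).Nonempty := by
  obtain ⟨hj, hle⟩ := (R.mem_order₁ p).1 hp
  have := Splitting.exists_candidate_nonempty hγ hj (R.cand₁_spec _ _ hj) (R.cand₂_spec _ _ hj)
  rw [min_eq_left hle] at this
  exact Splitting.nonempty_of_maxDist_lt_top this

lemma cand₂_nonempty {A : Ω} {j : D} (hj : j ∈ R.order₂ A) : (R.cand₂ A j).Nonempty :=
  Splitting.nonempty_of_maxDist_lt_top (((R.mem_order₂ A j).1 hj).2.trans_le le_top)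

lemma connect_nonneg (G : Finset F) (j : D) : 0 ≤ R.connect G j := by
  unfold connect
  split_ifs with h
  · exact (Finset.le_inf'_iff h _).2 fun i _ => I.c_nonneg i j
  · exact le_rfl

variable [DecidableEq K]

lemma openProb_eq (t : Option Ω) (O : Finset K) :
    R.openProb t O = roundProb R.ybar (R.clusters t) (R.copies t) O := by
  unfold openProb roundProb unclustered
  congr 1
  exact Finset.prod_congr (by ext k; simp) fun _ _ => rfl

lemma openProb_nonneg (t : Option Ω) (O : Finset K) : 0 ≤ R.openProb t O := by
  rw [openProb_eq]
  exact roundProb_nonneg R.ybar_nonneg R.ybar_le_one O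

lemma isClustering (hγ : 2 ≤ γ) (t : Option Ω) :
    IsClustering R.ybar (R.clusters t) (R.copies t) := by
  have key : ∀ C ∈ R.clusters t, ∃ A, ∃ j ∈ I.scenario A, R.IsCandidate t A j C ∧ C.Nonempty := by
    intro C hC
    cases t with
    | none =>
      obtain ⟨p, hp, rfl⟩ := List.mem_map.1 (mem_of_mem_greedy hC)
      have hj := ((R.mem_order₁ p).1 hp).1
      exact ⟨p.1, p.2, hj, R.cand₁_spec _ _ hj, R.cand₁_nonempty hγ hp⟩
    | some A =>
      obtain ⟨j, hp, rfl⟩ := List.mem_map.1 (mem_of_mem_greedy hC)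
      have hj := ((R.mem_order₂ A j).1 hp).1
      exact ⟨A, j, hj, R.cand₂_spec _ _ hj, R.cand₂_nonempty hp⟩
  refine ⟨fun C hC => ?_, ?_, fun C hC => ?_⟩
  · obtain ⟨A, j, -, h, -⟩ := key C hC
    exact h.subset
  · cases t <;> exact greedy_pairwise_disjoint _
  · obtain ⟨A, j, hj, h, hne⟩ := key C hC
    exact h.sum_ybar hj hne

/-- Each client has a radius `d` below which it is served to an extent at most `2`, while it
always finds an open copy within `3 * d`. -/
lemma exists_radius (hγ : 2 ≤ γ) {A : Ω} {j : D} (hj : j ∈ I.scenario A) :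
    ∃ d : ℝ, 0 ≤ d ∧
      (∀ r < d, ∑ k ∈ R.copies none with I.c (R.parent k) j ≤ r, R.xbar A k j +
        ∑ k ∈ R.copies (some A) with I.c (R.parent k) j ≤ r, R.xbar A k j ≤ 2) ∧
      ∀ O₁ O₂, 0 < R.openProb none O₁ → 0 < R.openProb (some A) O₂ →
        ∃ k ∈ O₁ ∪ O₂, I.c (R.parent k) j ≤ 3 * d := by
  have hs₁ := R.cand₁_spec A j hj
  have hs₂ := R.cand₂_spec A j hj
  -- Below both radii each stage contributes at most `1`; this is the `2` of `integral_exp_neg_le`.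
  have hnear : ∀ r : ℝ, (r : WithTop ℝ) < R.maxDist j (R.cand₁ A j) →
      (r : WithTop ℝ) < R.maxDist j (R.cand₂ A j) →
      ∑ k ∈ R.copies none with I.c (R.parent k) j ≤ r, R.xbar A k j +
        ∑ k ∈ R.copies (some A) with I.c (R.parent k) j ≤ r, R.xbar A k j ≤ 2 := by
    intro r h1 h2
    linarith [hs₁.sum_near_le hj h1, hs₂.sum_near_le hj h2]
  rcases le_or_gt (R.maxDist j (R.cand₁ A j)) (R.maxDist j (R.cand₂ A j)) with hle | hlt
  · have hmem : (A, j) ∈ R.order₁ := (R.mem_order₁ (A, j)).2 ⟨hj, hle⟩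
    have hne := R.cand₁_nonempty hγ hmem
    obtain ⟨d, hd, hd0, -⟩ := R.exists_maxDist_eq (j := j) hne
    refine ⟨d, hd0, fun r hr => ?_, fun O₁ O₂ h1 _ => ?_⟩
    · have : (r : WithTop ℝ) < R.maxDist j (R.cand₁ A j) := hd ▸ WithTop.coe_lt_coe.2 hr
      exact hnear r this (this.trans_le hle)
    · obtain ⟨k, hk, hc⟩ := R.exists_fallback (f := fun p : Ω × D => R.cand₁ p.1 p.2)
        (g := Prod.snd) R.order₁_sorted hmem hne hd
        (fun C hC => exists_inter_eq_of_roundProb_pos (R.openProb_eq none O₁ ▸ h1) hC)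
      exact ⟨k, Finset.mem_union_left _ hk, hc⟩
  · have hmem : j ∈ R.order₂ A := (R.mem_order₂ A j).2 ⟨hj, hlt⟩
    have hne := R.cand₂_nonempty hmem
    obtain ⟨d, hd, hd0, -⟩ := R.exists_maxDist_eq (j := j) hne
    refine ⟨d, hd0, fun r hr => ?_, fun O₁ O₂ _ h2 => ?_⟩
    · have : (r : WithTop ℝ) < R.maxDist j (R.cand₂ A j) := hd ▸ WithTop.coe_lt_coe.2 hr
      exact hnear r (this.trans hlt) this
    · obtain ⟨k, hk, hc⟩ := R.exists_fallback (f := fun j : D => R.cand₂ A j)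
        (g := id) (R.order₂_sorted A) hmem hne hd
        (fun C hC => exists_inter_eq_of_roundProb_pos (R.openProb_eq (some A) O₂ ▸ h2) hC)
      exact ⟨k, Finset.mem_union_right _ hk, hc⟩

lemma connect_le {O₁ O₂ : Finset K} {k : K} (hk : k ∈ O₁ ∪ O₂) (j : D) :
    R.connect (R.opened O₁ ∪ R.opened O₂) j ≤ I.c (R.parent k) j := by
  have hmem : R.parent k ∈ R.opened O₁ ∪ R.opened O₂ := by
    rw [opened, opened, ← Finset.image_union]
    exact Finset.mem_image_of_mem _ hk
  rw [connect, dif_pos ⟨_, hmem⟩]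
  exact Finset.inf'_le _ hmem

lemma expected_connect_le (R : Run s 2.4957 K) {A : Ω} {j : D} (hj : j ∈ I.scenario A) :
    ∑ O₁ ∈ (R.copies none).powerset, ∑ O₂ ∈ (R.copies (some A)).powerset,
        R.openProb none O₁ * R.openProb (some A) O₂ *
          R.connect (R.opened O₁ ∪ R.opened O₂) j ≤
      2.4957 * ∑ i, I.c i j * s.x A i j := by
  obtain ⟨d, hd, hnear, hfar⟩ := R.exists_radius (by norm_num) hj
  simp only [openProb_eq] at hfar ⊢
  rw [← R.sum_mul_xbar hj fun i => I.c i j]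
  refine sum_connection_le (x := fun k => R.xbar A k j) (c := fun k => I.c (R.parent k) j)
    (κ := fun O₁ O₂ => R.connect (R.opened O₁ ∪ R.opened O₂) j)
    (R.isClustering (by norm_num) none)
    (R.isClustering (by norm_num) (some A)) R.ybar_nonneg R.ybar_le_one
    (fun k => R.xbar_eq A k j hj) (fun k => I.c_nonneg _ _) hd
    (R.le_sum_xbar (by norm_num) hj) hnear (fun _ _ => R.connect_nonneg _ _)
    (fun _ _ k hk => R.connect_le hk j) fun O₁ O₂ h1 h2 => ?_
  obtain ⟨k, hk, hc⟩ := hfar O₁ O₂ h1 h2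
  exact (R.connect_le hk j).trans hc

lemma expected_opening_le (hγ : 2 ≤ γ) (t : Option Ω) {f : F → ℝ} (hf : ∀ i, 0 ≤ f i) :
    ∑ O ∈ (R.copies t).powerset, R.openProb t O * ∑ i ∈ R.opened O, f i ≤
      γ * ∑ i, f i * s.opening t i := by
  have hcl := R.isClustering hγ t
  calc ∑ O ∈ (R.copies t).powerset, R.openProb t O * ∑ i ∈ R.opened O, f i
      ≤ ∑ O ∈ (R.copies t).powerset, R.openProb t O *
          ∑ k ∈ R.copies t, f (R.parent k) * if k ∈ O then 1 else 0 := by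
        -- Charging every open copy separately only overcounts, since a facility with several open
        -- copies is paid once.
        refine Finset.sum_le_sum fun O hO => mul_le_mul_of_nonneg_left ?_
          (R.openProb_nonneg t O)
        have hO := Finset.mem_powerset.1 hO
        simp only [mul_ite, mul_one, mul_zero]
        rw [← Finset.sum_filter, Finset.filter_mem_eq_inter, Finset.inter_eq_right.2 hO]
        exact Finset.sum_image_le_of_nonneg (g := R.parent) (f := f) fun i _ => hf i
    _ = ∑ k ∈ R.copies t, f (R.parent k) *
          ∑ O ∈ (R.copies t).powerset, R.openProb t O * if k ∈ O then 1 else 0 := by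
        simp only [Finset.mul_sum]
        rw [Finset.sum_comm]
        exact Finset.sum_congr rfl fun _ _ => Finset.sum_congr rfl fun _ _ => by ring
    _ ≤ ∑ k ∈ R.copies t, f (R.parent k) * R.ybar k := by
        refine Finset.sum_le_sum fun k hk => mul_le_mul_of_nonneg_left ?_ (hf _)
        simp only [openProb_eq]
        exact sum_roundProb_mem_le hcl R.ybar_nonneg R.ybar_le_one hk
    _ = γ * ∑ i, f i * s.opening t i := by
        rw [R.sum_copies t f R.ybar, Finset.mul_sum]
        exact Finset.sum_congr rfl fun i _ => by rw [R.sum_ybar t i]; ring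

lemma sum_openProb (hγ : 2 ≤ γ) (t : Option Ω) :
    ∑ O ∈ (R.copies t).powerset, R.openProb t O = 1 := by
  simp only [openProb_eq]
  exact sum_roundProb (R.isClustering hγ t)

lemma expectedCost_le (R : Run s 2.4957 K) (A : Ω) : R.expectedCost A ≤ 2.4957 * s.val A := by
  have h₁ := R.expected_opening_le (by norm_num) none I.f₁_nonneg
  have h₂ := R.expected_opening_le (by norm_num) (some A) (I.f₂_nonneg A)
  have h₃ := Finset.sum_le_sum fun j (hj : j ∈ I.scenario A) => R.expected_connect_le hj
  have s₁ := R.sum_openProb (by norm_num) none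
  have s₂ := R.sum_openProb (by norm_num) (some A)
  have e : R.expectedCost A =
      ∑ O ∈ (R.copies none).powerset, R.openProb none O * ∑ i ∈ R.opened O, I.f₁ i +
      ∑ O ∈ (R.copies (some A)).powerset, R.openProb (some A) O * ∑ i ∈ R.opened O, I.f₂ A i +
      ∑ j ∈ I.scenario A, ∑ O₁ ∈ (R.copies none).powerset,
        ∑ O₂ ∈ (R.copies (some A)).powerset, R.openProb none O₁ * R.openProb (some A) O₂ *
          R.connect (R.opened O₁ ∪ R.opened O₂) j := by
    simp only [expectedCost, cost, mul_add, Finset.sum_add_distrib]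
    congr 2
    · refine Finset.sum_congr rfl fun O₁ _ => ?_
      rw [← Finset.sum_mul, ← Finset.mul_sum, s₂, mul_one]
    · rw [Finset.sum_comm]
      refine Finset.sum_congr rfl fun O₂ _ => ?_
      rw [← Finset.sum_mul, ← Finset.sum_mul, s₁, one_mul]
    · rw [Finset.sum_comm (s := I.scenario A)]
      refine Finset.sum_congr rfl fun O₁ _ => ?_
      rw [Finset.sum_comm]
      exact Finset.sum_congr rfl fun O₂ _ => by rw [Finset.mul_sum]
  rw [e]
  rw [← Finset.mul_sum] at h₃
  simp only [FracSol.val, Finset.sum_add_distrib, mul_add]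
  exact add_le_add (add_le_add h₁ h₂) h₃

end Run

/-! ### Cutting half-lines, and nearest parts of unit weight -/

section Pieces

/-- The weight of `b` is its distance to the preceding point of `B`, or to `0` for the smallest; the
sums telescope. -/
lemma exists_gaps (B : Finset ℝ) (hB : ∀ b ∈ B, 0 ≤ b) :
    ∃ w : ℝ → ℝ, (∀ b, 0 ≤ w b) ∧ ∀ a ∈ B, ∑ b ∈ B with b ≤ a, w b = a := by
  induction B using Finset.induction_on_max with
  | empty => exact ⟨0, fun _ => le_rfl, by simp⟩
  | insert m B hm ih =>
    obtain ⟨w, hw, hsum⟩ := ih fun b hb => hB b (Finset.mem_insert_of_mem hb)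
    have hmB : m ∉ B := fun h => (hm m h).false
    have hle : ∑ b ∈ B, w b ≤ m := by
      rcases B.eq_empty_or_nonempty with rfl | hne
      · simpa using hB m
      · have h := hsum _ (B.max'_mem hne)
        rw [Finset.filter_true_of_mem fun b hb => B.le_max' b hb] at h
        exact h.trans_le (hm _ (B.max'_mem hne)).le
    have hcongr : ∀ s ⊆ B, ∑ b ∈ s, Function.update w m (m - ∑ b ∈ B, w b) b = ∑ b ∈ s, w b :=
      fun s hs => Finset.sum_congr rfl fun b hb =>
        Function.update_of_ne (ne_of_mem_of_not_mem (hs hb) hmB) _ _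
    refine ⟨Function.update w m (m - ∑ b ∈ B, w b), fun b => ?_, fun a ha => ?_⟩
    · rcases eq_or_ne b m with rfl | h
      · simpa using hle
      · simpa [h] using hw b
    · rcases Finset.mem_insert.1 ha with rfl | ha
      · rw [Finset.filter_true_of_mem, Finset.sum_insert hmB, hcongr B subset_rfl,
          Function.update_self]
        · ring
        · intro b hb
          rcases Finset.mem_insert.1 hb with rfl | hb
          · exact le_rfl
          · exact (hm b hb).le
      · rw [Finset.filter_insert, if_neg (hm a ha).not_ge, hcongr _ (Finset.filter_subset _ _),
          hsum a ha]

/-- Adding the integers `0, …, N` to the cutting points makes every gap at most `1`. -/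
lemma exists_short_gaps (B : Finset ℝ) (hB : ∀ b ∈ B, 0 ≤ b) :
    ∃ (B' : Finset ℝ) (w : ℝ → ℝ), (∀ b ∈ B', 0 ≤ w b ∧ w b ≤ 1) ∧
      ∀ a ∈ B, ∑ b ∈ B' with b ≤ a, w b = a := by
  obtain ⟨N, hN⟩ : ∃ N : ℕ, ∀ b ∈ B, b ≤ N := by
    obtain ⟨M, hM⟩ := B.bddAbove
    obtain ⟨N, hN⟩ := exists_nat_ge M
    exact ⟨N, fun b hb => (hM hb).trans hN⟩
  set B' := B ∪ (Finset.range (N + 1)).image fun n : ℕ => (n : ℝ) with hB'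
  have hmem : ∀ n : ℕ, n ≤ N → (n : ℝ) ∈ B' := fun n hn =>
    Finset.mem_union_right _ (Finset.mem_image.2 ⟨n, by simpa [Nat.lt_succ_iff] using hn, rfl⟩)
  have hbd : ∀ b ∈ B', 0 ≤ b ∧ b ≤ N := by
    intro b hb
    rcases Finset.mem_union.1 hb with hb | hb
    · exact ⟨hB b hb, hN b hb⟩
    · obtain ⟨n, hn, rfl⟩ := Finset.mem_image.1 hb
      exact ⟨n.cast_nonneg, by exact_mod_cast Nat.lt_succ_iff.1 (Finset.mem_range.1 hn)⟩
  obtain ⟨w, hw, hsum⟩ := exists_gaps B' fun b hb => (hbd b hb).1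
  refine ⟨B', w, fun b hb => ⟨hw b, ?_⟩, fun a ha => hsum a (Finset.mem_union_left _ ha)⟩
  have hself : b ∈ B'.filter (· ≤ b) := Finset.mem_filter.2 ⟨hb, le_rfl⟩
  -- For `b > 0` the cutting point `⌈b⌉₊ - 1` lies strictly below `b` at distance at most `1`, which
  -- bounds the gap. At `b = 0` the natural subtraction truncates, so that case is separate.
  rcases (hbd b hb).1.eq_or_lt with h0 | h0
  · have h1 := Finset.single_le_sum (f := w) (fun b _ => hw b) hself
    rw [hsum b hb] at h1
    linarith
  · have hc1 : 1 ≤ ⌈b⌉₊ := Nat.one_le_iff_ne_zero.2 (Nat.ceil_pos.2 h0).ne'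
    have hcN : ⌈b⌉₊ ≤ N := Nat.ceil_le.2 (hbd b hb).2
    have hlt : ((⌈b⌉₊ - 1 : ℕ) : ℝ) < b := Nat.lt_ceil.1 (by omega)
    have hge : b ≤ ((⌈b⌉₊ - 1 : ℕ) : ℝ) + 1 := by
      rw [Nat.cast_sub hc1]
      have := Nat.le_ceil b
      push_cast; linarith
    have hs := hsum _ (hmem (⌈b⌉₊ - 1) (by omega))
    have hnot : b ∉ B'.filter (· ≤ ((⌈b⌉₊ - 1 : ℕ) : ℝ)) := fun h =>
      absurd (Finset.mem_filter.1 h).2 hlt.not_ge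
    have hsub : insert b (B'.filter (· ≤ ((⌈b⌉₊ - 1 : ℕ) : ℝ))) ⊆ B'.filter (· ≤ b) := by
      intro v hv
      rcases Finset.mem_insert.1 hv with rfl | hv
      · exact hself
      · obtain ⟨h1, h2⟩ := Finset.mem_filter.1 hv
        exact Finset.mem_filter.2 ⟨h1, h2.trans hlt.le⟩
    have h1 := Finset.sum_le_sum_of_subset_of_nonneg (f := w) hsub fun b _ _ => hw b
    rw [Finset.sum_insert hnot, hs, hsum b hb] at h1
    linarith

/-- A half-line for each index, cut into finitely many short pieces with prescribed cutting
points. -/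
lemma exists_pieces {ι : Type*} [Fintype ι] [DecidableEq ι] (B : Finset ℝ) (hB : ∀ b ∈ B, 0 ≤ b) :
    ∃ (n : ℕ) (idx : Fin n → ι) (pos len : Fin n → ℝ), (∀ k, 0 ≤ len k ∧ len k ≤ 1) ∧
      ∀ i, ∀ a ∈ B, ∑ k with idx k = i ∧ pos k ≤ a, len k = a := by
  obtain ⟨B', w, hw, hsum⟩ := exists_short_gaps B hB
  have e := Fintype.equivFin (ι × B')
  refine ⟨_, fun k => (e.symm k).1, fun k => (e.symm k).2, fun k => w (e.symm k).2,
    fun k => hw _ (e.symm k).2.2, fun i a ha => ?_⟩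
  rw [Finset.sum_filter,
    e.symm.sum_comp (fun p : ι × B' => if p.1 = i ∧ (p.2 : ℝ) ≤ a then w p.2 else 0),
    Fintype.sum_prod_type, Finset.sum_eq_single i]
  · simp only [true_and]
    rw [Finset.sum_coe_sort B' (fun b => if b ≤ a then w b else 0), ← Finset.sum_filter]
    exact hsum a ha
  · intro i' _ hne
    simp [hne]
  · simp

/-- The closest part of total weight `1` of a weight distribution. -/
lemma exists_closest_part {F : Type*} [Fintype F] (a c : F → ℝ) (ha : ∀ i, 0 ≤ a i)
    (hsum : 1 ≤ ∑ i, a i) :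
    ∃ (b : F → ℝ) (r : ℝ), (∀ i, 0 ≤ b i ∧ b i ≤ a i) ∧ ∑ i, b i = 1 ∧
      (∀ i, b i ≠ 0 → c i ≤ r) ∧ ∑ i with c i < r, a i < 1 := by
  classical
  have hF : (Finset.univ : Finset F).Nonempty := by
    rw [Finset.nonempty_iff_ne_empty]
    intro h
    rw [h] at hsum
    simp at hsum
    linarith
  obtain ⟨i₁, -, hi₁⟩ := Finset.exists_max_image Finset.univ c hF
  have hne : ({i | 1 ≤ ∑ i' with c i' ≤ c i, a i'} : Finset F).Nonempty :=
    ⟨i₁, by simpa [Finset.filter_true_of_mem hi₁] using hsum⟩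
  -- `c i₀` is the smallest radius whose closed ball has weight at least `1`; its open ball then has
  -- weight below `1`.
  obtain ⟨i₀, h₀, hmin⟩ := Finset.exists_min_image _ c hne
  simp only [Finset.mem_filter, Finset.mem_univ, true_and] at h₀ hmin
  have hlt : ∑ i with c i < c i₀, a i < 1 := by
    by_contra! hge
    have hne' : ({i | c i < c i₀} : Finset F).Nonempty := by
      rw [Finset.nonempty_iff_ne_empty]
      intro h
      rw [h] at hge
      simp at hge
      linarith
    obtain ⟨i₂, h₂, hmax⟩ := Finset.exists_max_image _ c hne'
    refine (Finset.mem_filter.1 h₂).2.not_ge (hmin i₂ (hge.trans ?_))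
    refine Finset.sum_le_sum_of_subset_of_nonneg (fun i hi => ?_) fun i _ _ => ha i
    simpa using hmax i hi
  have hsplit : ∑ i with c i ≤ c i₀, a i =
      ∑ i with c i < c i₀, a i + ∑ i with c i = c i₀, a i := by
    simp only [Finset.sum_filter]
    rw [← Finset.sum_add_distrib]
    refine Finset.sum_congr rfl fun i _ => ?_
    rcases lt_trichotomy (c i) (c i₀) with h | h | h
    · simp [h, h.le, h.ne]
    · simp [h]
    · simp [h.not_ge, h.not_gt, h.ne']
  set u := ∑ i with c i < c i₀, a i with hu
  set v := ∑ i with c i = c i₀, a i with hv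
  have hvpos : 0 < v := by linarith
  -- The open ball is used fully; the sphere of weight `v` is used to the fraction that fills the
  -- missing `1 - u`.
  set θ := (1 - u) / v with hθ
  have hθ0 : 0 ≤ θ := div_nonneg (by linarith) hvpos.le
  have hθ1 : θ ≤ 1 := (div_le_one hvpos).2 (by linarith)
  refine ⟨fun i => if c i < c i₀ then a i else if c i = c i₀ then θ * a i else 0, c i₀,
    fun i => ?_, ?_, fun i hi => ?_, hlt⟩
  · have := ha i
    dsimp only
    split_ifs
    · exact ⟨this, le_rfl⟩
    · exact ⟨mul_nonneg hθ0 this, mul_le_of_le_one_left this hθ1⟩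
    · exact ⟨le_rfl, this⟩
  · have : ∑ i, (if c i < c i₀ then a i else if c i = c i₀ then θ * a i else 0) = u + θ * v := by
      rw [hu, hv, Finset.mul_sum]
      simp only [Finset.sum_filter]
      rw [← Finset.sum_add_distrib]
      refine Finset.sum_congr rfl fun i _ => ?_
      rcases lt_trichotomy (c i) (c i₀) with h | h | h
      · simp [h, h.ne]
      · simp [h]
      · simp [h.not_gt, h.ne']
    rw [this, hθ, div_mul_cancel₀ _ hvpos.ne']
    ring
  · by_contra! h
    simp [h.not_gt, h.ne'] at hi

lemma exists_sorted_list {α β : Type*} [LinearOrder β] (f : α → β) (s : Finset α) :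
    ∃ l : List α, l.Nodup ∧ (∀ a, a ∈ l ↔ a ∈ s) ∧ l.Pairwise fun a b => f a ≤ f b := by
  classical
  induction s using Finset.induction_on_max_value f with
  | empty => exact ⟨[], by simp, by simp, by simp⟩
  | insert a s ha hmax ih =>
    obtain ⟨l, hl, hmem, hp⟩ := ih
    refine ⟨l ++ [a], ?_, fun b => by simp [hmem, or_comm], ?_⟩
    · rw [List.nodup_append]
      refine ⟨hl, by simp, fun x hx y hy h => ?_⟩
      obtain rfl : y = a := by simpa using hy
      exact ha ((hmem _).1 (h ▸ hx))
    · exact List.pairwise_append.2 ⟨hp, by simp, fun x hx y hy => by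
        obtain rfl : y = a := by simpa using hy
        exact hmax x ((hmem x).1 hx)⟩

end Pieces

/-! ### Existence of a run -/

section Existence
variable {F D Ω X : Type*} [PseudoMetricSpace X] [Fintype F] {I : Inst F D Ω X}

lemma FracSol.opening_nonneg (s : FracSol I) (t : Option Ω) (i : F) : 0 ≤ s.opening t i := by
  cases t with
  | none => exact s.y₁_nonneg i
  | some A => exact s.y₂_nonneg A i

variable [DecidableEq Ω]

/-- The part of `x A i j` that is served in a given stage. -/
noncomputable def FracSol.served (s : FracSol I) : Option Ω → Ω → F → D → ℝ
  | none, A, i, j => s.x₁ A i j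
  | some A', A, i, j => if A' = A then s.x₂ A i j else 0

/-- Since `x ≤ y₁ + y₂`, the proportional share of a stage fits into its opening. Served amounts can
thus be initial segments of the opening segment. -/
lemma FracSol.served_bounds (s : FracSol I) (t : Option Ω) {A : Ω} {j : D}
    (hj : j ∈ I.scenario A) (i : F) :
    0 ≤ s.served t A i j ∧ s.served t A i j ≤ s.opening t i := by
  have h1 := s.y₁_nonneg i
  have h2 := s.y₂_nonneg A i
  have h3 := s.x_nonneg A i j hj
  have h4 := s.x_le A i j hj
  have key : ∀ y, 0 ≤ y → 0 ≤ s.x A i j * (y / (s.y₁ i + s.y₂ A i)) ∧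
      s.x A i j * (y / (s.y₁ i + s.y₂ A i)) ≤ y := by
    intro y hy
    refine ⟨mul_nonneg h3 (div_nonneg hy (by linarith)), ?_⟩
    rcases eq_or_ne (s.y₁ i + s.y₂ A i) 0 with h | h
    · simp [h, hy]
    · have hpos : 0 < s.y₁ i + s.y₂ A i := lt_of_le_of_ne (by linarith) h.symm
      rw [mul_div_assoc', div_le_iff₀ hpos, mul_comm]
      exact mul_le_mul_of_nonneg_left h4 hy
  cases t with
  | none => exact key _ h1
  | some A' =>
    rw [served, opening]
    split_ifs with h
    · subst h
      exact key _ h2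
    · exact ⟨le_rfl, s.y₂_nonneg A' i⟩

variable [DecidableEq F] [Fintype Ω]

lemma exists_splitting (s : FracSol I) {γ : ℝ} (hγ : 0 ≤ γ) :
    ∃ (n : ℕ) (S : Splitting s γ (Fin n)),
      ∀ t A, ∀ j ∈ I.scenario A, ∃ G, S.IsCandidate t A j G := by
  classical
  have hpart : ∀ t A j, ∃ (b : F → ℝ) (r : ℝ), (∀ i, 0 ≤ b i) ∧
      (j ∈ I.scenario A → 1 ≤ ∑ i, γ * s.served t A i j →
        (∀ i, b i ≤ γ * s.served t A i j) ∧ ∑ i, b i = 1 ∧ (∀ i, b i ≠ 0 → I.c i j ≤ r) ∧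
          ∑ i with I.c i j < r, γ * s.served t A i j < 1) := by
    intro t A j
    by_cases h : j ∈ I.scenario A ∧ 1 ≤ ∑ i, γ * s.served t A i j
    · obtain ⟨b, r, hb, h1, h2, h3⟩ := exists_closest_part _ (fun i => I.c i j)
        (fun i => mul_nonneg hγ (s.served_bounds t h.1 i).1) h.2
      exact ⟨b, r, fun i => (hb i).1, fun _ _ => ⟨fun i => (hb i).2, h1, h2, h3⟩⟩
    · exact ⟨0, 0, fun _ => le_rfl, fun h1 h2 => (h ⟨h1, h2⟩).elim⟩
  choose b r hb0 hb using hpart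
  -- Cutting at openings and served amounts makes each pair use a copy fully or not at all; cutting
  -- at the nearest unit parts `b` lets candidates have weight exactly `1`.
  set B : Finset ℝ := (Finset.univ : Finset (Option Ω × F)).biUnion fun p =>
    insert (γ * s.opening p.1 p.2) (Finset.univ.biUnion fun A => (I.scenario A).biUnion fun j =>
      {γ * s.served p.1 A p.2 j, b p.1 A j p.2}) with hBdef
  have hBo : ∀ t i, γ * s.opening t i ∈ B := fun t i =>
    Finset.mem_biUnion.2 ⟨(t, i), Finset.mem_univ _, Finset.mem_insert_self _ _⟩
  have hBs : ∀ t i A, ∀ j ∈ I.scenario A, γ * s.served t A i j ∈ B ∧ b t A j i ∈ B := by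
    intro t i A j hj
    have : ∀ v ∈ ({γ * s.served t A i j, b t A j i} : Finset ℝ), v ∈ B := fun v hv =>
      Finset.mem_biUnion.2 ⟨(t, i), Finset.mem_univ _, Finset.mem_insert_of_mem
        (Finset.mem_biUnion.2 ⟨A, Finset.mem_univ _, Finset.mem_biUnion.2 ⟨j, hj, hv⟩⟩)⟩
    exact ⟨this _ (by simp), this _ (by simp)⟩
  have hB0 : ∀ v ∈ B, 0 ≤ v := by
    intro v hv
    simp only [hBdef, Finset.mem_biUnion, Finset.mem_insert, Finset.mem_singleton,
      Finset.mem_univ, true_and] at hv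
    obtain ⟨p, rfl | ⟨A, j, hj, rfl | rfl⟩⟩ := hv
    · exact mul_nonneg hγ (s.opening_nonneg _ _)
    · exact mul_nonneg hγ (s.served_bounds _ hj _).1
    · exact hb0 _ _ _ _
  obtain ⟨n, idx, pos, len, hlen, hsum⟩ := exists_pieces (ι := Option Ω × F) B hB0
  have hsum' : ∀ (a : Option Ω → F → ℝ) (t : Option Ω) (i : F), a t i ∈ B →
      ∑ k with (idx k).2 = i ∧ (idx k).1 = t,
        (if pos k ≤ a (idx k).1 (idx k).2 then len k else 0) = a t i := by
    intro a t i ha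
    rw [← hsum (t, i) _ ha, ← Finset.sum_filter, Finset.filter_filter]
    refine Finset.sum_congr (Finset.filter_congr fun k _ => ?_) fun _ _ => rfl
    rw [Prod.ext_iff]
    constructor
    · rintro ⟨⟨h1, h2⟩, h3⟩
      exact ⟨⟨h2, h1⟩, by rwa [h1, h2] at h3⟩
    · rintro ⟨⟨h2, h1⟩, h3⟩
      dsimp only at h1 h2
      exact ⟨⟨h1, h2⟩, by rwa [h1, h2]⟩
  -- A segment of length `0` may still contain pieces in the sense of `pos k ≤ 0`, but they have
  -- length `0`.
  have hzero : ∀ (a : Option Ω → F → ℝ) (k : Fin n), a (idx k).1 (idx k).2 = 0 →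
      (0 : ℝ) ∈ B → pos k ≤ a (idx k).1 (idx k).2 → len k = 0 := by
    intro a k ha hB hk
    have h1 := hsum (idx k) 0 hB
    refine (Finset.sum_eq_zero_iff_of_nonneg fun k _ => (hlen k).1).1 h1 k ?_
    simpa using ha ▸ hk
  let S : Splitting s γ (Fin n) :=
    { parent := fun k => (idx k).2
      stage := fun k => (idx k).1
      ybar := fun k => if pos k ≤ γ * s.opening (idx k).1 (idx k).2 then len k else 0
      xbar := fun A k j => if pos k ≤ γ * s.served (idx k).1 A (idx k).2 j then len k else 0
      ybar_nonneg := fun k => by split_ifs; exacts [(hlen k).1, le_rfl]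
      ybar_le_one := fun k => by split_ifs; exacts [(hlen k).2, zero_le_one]
      sum_ybar := fun t i => hsum' (fun t i => γ * s.opening t i) t i (hBo t i)
      xbar_eq := fun A k j hj => by
        by_cases h : pos k ≤ γ * s.served (idx k).1 A (idx k).2 j
        · right
          rw [if_pos h, if_pos (h.trans (mul_le_mul_of_nonneg_left
            (s.served_bounds _ hj _).2 hγ))]
        · left
          rw [if_neg h]
      xbar_other := fun A k j hj h1 h2 => by
        have h0 : γ * s.served (idx k).1 A (idx k).2 j = 0 := by
          obtain ⟨A', hA'⟩ := Option.ne_none_iff_exists'.1 h1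
          rw [hA'] at h2 ⊢
          have : A' ≠ A := fun h => h2 (by rw [h])
          simp [FracSol.served, this]
        split_ifs with h
        · exact hzero (fun t i => γ * s.served t A i j) k h0
            (h0 ▸ (hBs (idx k).1 (idx k).2 A j hj).1) h
        · rfl
      sum_xbar₁ := fun A i j hj =>
        hsum' (fun t i => γ * s.served t A i j) none i (hBs none i A j hj).1
      sum_xbar₂ := fun A i j hj => by
        have := hsum' (fun t i => γ * s.served t A i j) (some A) i (hBs (some A) i A j hj).1
        simpa [FracSol.served] using this }
  have hSx : ∀ A k j, S.xbar A k j =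
    if pos k ≤ γ * s.served (idx k).1 A (idx k).2 j then len k else 0 := fun _ _ _ => rfl
  have hSp : ∀ k, S.parent k = (idx k).2 := fun _ => rfl
  have hSs : ∀ k, S.stage k = (idx k).1 := fun _ => rfl
  refine ⟨n, S, fun t A j hj => ?_⟩
  have hmass : ∀ g : F → ℝ, ∑ k ∈ S.copies t, g (S.parent k) * S.xbar A k j =
      ∑ i, g i * (γ * s.served t A i j) := by
    intro g
    rw [S.sum_copies t g fun k => S.xbar A k j]
    refine Finset.sum_congr rfl fun i _ => ?_
    rw [← hsum' (fun t i => γ * s.served t A i j) t i (hBs t i A j hj).1]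
  have hmass1 : ∑ k ∈ S.copies t, S.xbar A k j = ∑ i, γ * s.served t A i j := by
    simpa using hmass fun _ => 1
  rcases lt_or_ge (∑ k ∈ S.copies t, S.xbar A k j) 1 with hlt | hge
  · exact ⟨∅, fun _ => rfl, fun h => absurd h hlt.not_ge⟩
  obtain ⟨hba, hb1, hbr, hlt⟩ := hb t A j hj (hmass1 ▸ hge)
  have hG : ∀ k, k ∈ S.copies t ∧ pos k ≤ b (idx k).1 A j (idx k).2 → S.xbar A k j = len k := by
    rintro k ⟨hk, hpos⟩
    rw [S.mem_copies, hSs] at hk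
    rw [hSx, if_pos]
    rw [hk] at hpos ⊢
    exact hpos.trans (hba _)
  -- The candidate consists of the initial segments of lengths `b`, without the pieces of length
  -- `0`, which serve nothing.
  refine ⟨{k ∈ S.copies t | pos k ≤ b (idx k).1 A j (idx k).2 ∧ 0 < len k},
    fun h => absurd h hge.not_gt, fun _ => ⟨Finset.filter_subset _ _, ?_, ?_, ?_⟩⟩
  · intro k hk
    obtain ⟨h1, h2, h3⟩ := Finset.mem_filter.1 hk
    rw [hG k ⟨h1, h2⟩]
    exact h3
  · have e1 : ∑ k ∈ S.copies t with pos k ≤ b (idx k).1 A j (idx k).2 ∧ 0 < len k,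
        S.xbar A k j =
        ∑ k ∈ S.copies t, if pos k ≤ b (idx k).1 A j (idx k).2 then len k else 0 := by
      rw [Finset.sum_filter]
      refine Finset.sum_congr rfl fun k hk => ?_
      by_cases h1 : pos k ≤ b (idx k).1 A j (idx k).2
      · rcases (hlen k).1.eq_or_lt with h2 | h2
        · simp [← h2]
        · simp [h1, h2, hG k ⟨hk, h1⟩]
      · simp [h1]
    have e2 := S.sum_copies t (fun _ => 1)
      fun k => if pos k ≤ b (idx k).1 A j (idx k).2 then len k else 0
    simp only [one_mul] at e2
    rw [e1, e2, ← hb1]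
    exact Finset.sum_congr rfl fun i _ =>
      hsum' (fun t i => b t A j i) t i (hBs t i A j hj).2
  · intro G' hG' hsum1
    -- Copies strictly closer than `r` serve the pair to an extent less than `1`, so any competitor
    -- reaches at least as far as `r`.
    have hfar : ∃ k ∈ G', r t A j ≤ I.c (S.parent k) j := by
      by_contra! hnear
      refine absurd hsum1 (lt_of_le_of_lt ?_ hlt).not_ge
      have e := hmass fun i => if I.c i j < r t A j then 1 else 0
      simp only [ite_mul, one_mul, zero_mul] at e
      rw [Finset.sum_filter, ← e, ← Finset.sum_filter (s := S.copies t)]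
      exact Finset.sum_le_sum_of_subset_of_nonneg
        (fun k hk => Finset.mem_filter.2 ⟨hG' hk, hnear k hk⟩) fun k _ _ => S.xbar_nonneg hj k
    obtain ⟨k, hk, hkr⟩ := hfar
    have hr : ((r t A j : ℝ) : WithTop ℝ) ≤ S.maxDist j G' := by
      rw [Splitting.maxDist, dif_pos ⟨k, hk⟩, WithTop.coe_le_coe]
      exact hkr.trans (Finset.le_sup' (fun k => I.c (S.parent k) j) hk)
    refine le_trans ?_ hr
    -- An empty set would have `maxDist` equal to `⊤`.
    have hne : ({k ∈ S.copies t | pos k ≤ b (idx k).1 A j (idx k).2 ∧ 0 < len k}).Nonempty := by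
      obtain ⟨i, -, hi⟩ := Finset.exists_ne_zero_of_sum_ne_zero (hb1.trans_ne one_ne_zero)
      have h1 := hsum' (fun t i => b t A j i) t i (hBs t i A j hj).2
      obtain ⟨k, hk, hk0⟩ := Finset.exists_ne_zero_of_sum_ne_zero (h1.trans_ne hi)
      have hpos : pos k ≤ b (idx k).1 A j (idx k).2 := by
        by_contra h
        exact hk0 (if_neg h)
      rw [if_pos hpos] at hk0
      exact ⟨k, Finset.mem_filter.2 ⟨S.mem_copies.2 (Finset.mem_filter.1 hk).2.2, hpos,
        lt_of_le_of_ne (hlen k).1 hk0.symm⟩⟩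
    refine (S.maxDist_le_iff hne).2 fun k hk => ?_
    obtain ⟨h1, h2, h3⟩ := Finset.mem_filter.1 hk
    rw [S.mem_copies, hSs] at h1
    refine hbr _ fun h0 => h3.ne' ?_
    rw [hSp] at h0
    exact hzero (fun t i => b t A j i) k (by rw [h1]; exact h0)
      (h0 ▸ (hBs t (idx k).2 A j hj).2) h2

lemma exists_run (s : FracSol I) {γ : ℝ} (hγ : 0 ≤ γ) :
    ∃ n : ℕ, Nonempty (Run s γ (Fin n)) := by
  classical
  obtain ⟨n, S, hS⟩ := exists_splitting s hγ
  have hcand : ∀ t A j, ∃ G, j ∈ I.scenario A → S.IsCandidate t A j G := by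
    intro t A j
    by_cases hj : j ∈ I.scenario A
    · obtain ⟨G, hG⟩ := hS t A j hj
      exact ⟨G, fun _ => hG⟩
    · exact ⟨∅, fun h => (hj h).elim⟩
  choose G hG using hcand
  obtain ⟨l₁, n₁, m₁, p₁⟩ := exists_sorted_list
    (fun p : Ω × D => S.maxDist p.2 (G none p.1 p.2))
    ((Finset.univ.biUnion fun A => (I.scenario A).image fun j => (A, j)).filter fun p =>
      S.maxDist p.2 (G none p.1 p.2) ≤ S.maxDist p.2 (G (some p.1) p.1 p.2))
  have h₂ := fun A : Ω => exists_sorted_list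
    (fun j : D => S.maxDist j (G (some A) A j))
    ((I.scenario A).filter fun j =>
      S.maxDist j (G (some A) A j) < S.maxDist j (G none A j))
  choose l₂ n₂ m₂ p₂ using h₂
  exact ⟨n, ⟨{ S with
    cand₁ := G none
    cand₂ := fun A => G (some A) A
    cand₁_spec := fun A j hj => hG none A j hj
    cand₂_spec := fun A j hj => hG (some A) A j hj
    order₁ := l₁
    order₁_nodup := n₁
    mem_order₁ := fun p => by
      obtain ⟨A, j⟩ := p
      rw [m₁]
      simp
    order₁_sorted := p₁
    order₂ := l₂
    order₂_nodup := n₂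
    mem_order₂ := fun A j => by
      rw [m₂]
      simp
    order₂_sorted := p₂ }⟩⟩

end Existence

end StochFacLoc

theorem mainTheorem3 {F D Ω X : Type*} [Fintype F] [DecidableEq F] [Fintype Ω] [DecidableEq Ω]
    [PseudoMetricSpace X] (I : StochFacLoc.Inst F D Ω X) (s : StochFacLoc.FracSol I) :
    (∃ n : ℕ, Nonempty (StochFacLoc.Run s 2.4957 (Fin n))) ∧
    ∀ (K : Type*) [Fintype K] [DecidableEq K] (R : StochFacLoc.Run s 2.4957 K),
      (∀ t : Option Ω, (∀ O ∈ (R.copies t).powerset, 0 ≤ R.openProb t O) ∧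
        ∑ O ∈ (R.copies t).powerset, R.openProb t O = 1) ∧
      ∀ A : Ω,
        (∀ O₁ ∈ (R.copies none).powerset, ∀ O₂ ∈ (R.copies (some A)).powerset,
          0 < R.openProb none O₁ → 0 < R.openProb (some A) O₂ →
            ∀ j ∈ I.scenario A, (R.opened O₁ ∪ R.opened O₂).Nonempty) ∧
        R.expectedCost A ≤ 2.4957 * s.val A := by
  refine ⟨StochFacLoc.exists_run s (by norm_num), fun K _ _ R => ⟨fun t =>
    ⟨fun O _ => R.openProb_nonneg t O, R.sum_openProb (by norm_num) t⟩, fun A =>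
    ⟨fun O₁ _ O₂ _ h₁ h₂ j hj => ?_, R.expectedCost_le A⟩⟩⟩
  obtain ⟨d, -, -, hfar⟩ := R.exists_radius (by norm_num) hj
  obtain ⟨k, hk, -⟩ := hfar O₁ O₂ h₁ h₂
  rw [StochFacLoc.Run.opened, StochFacLoc.Run.opened, ← Finset.image_union]
  exact ⟨_, Finset.mem_image_of_mem _ hk⟩
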